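/- Let $A$ and $B$ be C*-algebras (not necessarily unital), let $A\otimes B$ denote their minimal (spatial) C*-tensor product, i.e. the completion of the algebraic tensor product in the norm $\|x\|=\sup_{\pi,\rho}\|(\pi\otimes\rho)(x)\|$, the supremum being over all $*$-representations $\pi$ of $A$ and $\rho$ of $B$ on Hilbert spaces, and for a C*-algebra $C$ let $M(C)\supseteq C$ denote its multiplier algebra, whose strict topology is the one generated by the maps $M(C)\to C$, $x\mapsto xc$ and $x\mapsto cx$ ($c\in C$). For $b\in B$ let $1\otimes b\in M(A\otimes B)$ be the multiplier with $(1\otimes b)(a\otimes c)=a\otimes bc$ and $(a\otimes c)(1\otimes b)=a\otimes cb$ for all $a\in A$, $c\in B$. Let $\omega\in A^*$ be a bounded linear functional. There is a unique bounded linear map $\omega\otimes\iota: A\otimes B\to B$ with $(\omega\otimes\iota)(a\otimes b)=\omega(a)b$ for all $a\in A$, $b\in B$ (the slice map). It admits a unique extension to a norm-bounded linear map $\omega\otimes\iota: M(A\otimes B)\to M(B)$ that is strictly continuous on the unit ball of $M(A\otimes B)$ (from the strict topology of $M(A\otimes B)$ to the strict topology of $M(B)$). Moreover, for all $x\in M(A\otimes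 B)$ and $b\in B$, $$b\,(\omega\otimes\iota)(x)=(\omega\otimes\iota)\big((1\otimes b)x\big)\quad\text{and}\quad (\omega\otimes\iota)(x)\,b=(\omega\otimes\iota)\big(x(1\otimes b)\big).$$ -/

import Mathlib

open UniformSpace
open scoped TensorProduct MultiplierAlgebra ComplexConjugate

noncomputable section

universe u v

/-! ## Representations and the spatial seminorm on the algebraic tensor product -/

/-- A representation of a C⋆-algebra on a Hilbert space.  The Hilbert space lives in the universe of
the algebra; this is enough room for the universal representation. -/
structure CStarRep (A : Type u) [NonUnitalCStarAlgebra A] where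
  /-- The underlying Hilbert space. -/
  space : Type u
  [normed : NormedAddCommGroup space]
  [innerProduct : InnerProductSpace ℂ space]
  [complete : CompleteSpace space]
  /-- The `⋆`-homomorphism into the bounded operators. -/
  hom : A →⋆ₙₐ[ℂ] (space →L[ℂ] space)

attribute [instance] CStarRep.normed CStarRep.innerProduct CStarRep.complete

namespace MinTensor

/-- The Hilbert space tensor product. -/
def HilbertTensor (H : Type u) (K : Type v) [NormedAddCommGroup H] [InnerProductSpace ℂ H]
    [NormedAddCommGroup K] [InnerProductSpace ℂ K] : Type (max u v) :=
  Completion (H ⊗[ℂ] K)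

section OpTensor

variable {H : Type u} {K : Type v} [NormedAddCommGroup H] [InnerProductSpace ℂ H]
  [NormedAddCommGroup K] [InnerProductSpace ℂ K]

instance : NormedAddCommGroup (HilbertTensor H K) :=
  inferInstanceAs (NormedAddCommGroup (Completion (H ⊗[ℂ] K)))
instance : InnerProductSpace ℂ (HilbertTensor H K) :=
  inferInstanceAs (InnerProductSpace ℂ (Completion (H ⊗[ℂ] K)))
instance : CompleteSpace (HilbertTensor H K) :=
  inferInstanceAs (CompleteSpace (Completion (H ⊗[ℂ] K)))

variable (H K) in
/-- The inclusion of the algebraic tensor product in the Hilbert space tensor product. -/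
def HilbertTensor.incl : H ⊗[ℂ] K →ₗᵢ[ℂ] HilbertTensor H K :=
  Completion.toComplₗᵢ

lemma HilbertTensor.denseRange_incl : DenseRange (HilbertTensor.incl H K) :=
  Completion.denseRange_coe

/-- The operator `S ⊗ T` on the Hilbert space tensor product. -/
def opTensor (S : H →L[ℂ] H) (T : K →L[ℂ] K) : HilbertTensor H K →L[ℂ] HilbertTensor H K :=
  (TensorProduct.mapL S T).completion

lemma opTensor_incl (S : H →L[ℂ] H) (T : K →L[ℂ] K) (x : H ⊗[ℂ] K) :
    opTensor S T (HilbertTensor.incl H K x) = HilbertTensor.incl H K (TensorProduct.mapL S T x) :=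
  ContinuousLinearMap.completion_apply_coe _ _

lemma ext_incl {F G : HilbertTensor H K →L[ℂ] HilbertTensor H K}
    (h : ∀ x, F (HilbertTensor.incl H K x) = G (HilbertTensor.incl H K x)) : F = G := by
  ext x
  exact congrFun (HilbertTensor.denseRange_incl.equalizer F.continuous G.continuous (funext h)) x

lemma opTensor_mul (S S' : H →L[ℂ] H) (T T' : K →L[ℂ] K) :
    opTensor (S * S') (T * T') = opTensor S T * opTensor S' T' :=
  ext_incl fun x => by
    rw [opTensor_incl, TensorProduct.mapL_mul]
    change _ = opTensor S T (opTensor S' T' _)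
    rw [opTensor_incl, opTensor_incl]
    rfl

lemma opTensor_add_left (S S' : H →L[ℂ] H) (T : K →L[ℂ] K) :
    opTensor (S + S') T = opTensor S T + opTensor S' T :=
  ext_incl fun x => by
    change _ = opTensor S T _ + opTensor S' T _
    simp only [opTensor_incl, TensorProduct.mapL_add_left, ← map_add]
    rfl

lemma opTensor_add_right (S : H →L[ℂ] H) (T T' : K →L[ℂ] K) :
    opTensor S (T + T') = opTensor S T + opTensor S T' :=
  ext_incl fun x => by
    change _ = opTensor S T _ + opTensor S T' _
    simp only [opTensor_incl, TensorProduct.mapL_add_right, ← map_add]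
    rfl

lemma opTensor_smul_left (c : ℂ) (S : H →L[ℂ] H) (T : K →L[ℂ] K) :
    opTensor (c • S) T = c • opTensor S T :=
  ext_incl fun x => by
    change _ = c • opTensor S T _
    rw [opTensor_incl, opTensor_incl, TensorProduct.mapL_smul_left, ← map_smul]
    rfl

lemma opTensor_smul_right (c : ℂ) (S : H →L[ℂ] H) (T : K →L[ℂ] K) :
    opTensor S (c • T) = c • opTensor S T :=
  ext_incl fun x => by
    change _ = c • opTensor S T _
    rw [opTensor_incl, opTensor_incl, TensorProduct.mapL_smul_right, ← map_smul]
    rfl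

lemma norm_opTensor_le (S : H →L[ℂ] H) (T : K →L[ℂ] K) : ‖opTensor S T‖ ≤ ‖S‖ * ‖T‖ := by
  refine ContinuousLinearMap.opNorm_le_bound _ (by positivity) fun x => ?_
  induction x using HilbertTensor.denseRange_incl.induction_on with
  | hp => exact isClosed_le (by fun_prop) (by fun_prop)
  | ih x =>
    rw [opTensor_incl, LinearIsometry.norm_map, LinearIsometry.norm_map]
    exact (ContinuousLinearMap.le_opNorm _ x).trans
      (mul_le_mul_of_nonneg_right (TensorProduct.norm_mapL_le S T) (norm_nonneg x))

lemma opTensor_star [CompleteSpace H] [CompleteSpace K] (S : H →L[ℂ] H) (T : K →L[ℂ] K) :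
    opTensor (star S) (star T) = star (opTensor S T) := by
  rw [ContinuousLinearMap.star_eq_adjoint (opTensor S T), ContinuousLinearMap.eq_adjoint_iff]
  intro x y
  induction x, y using HilbertTensor.denseRange_incl.induction_on₂ with
  | hp => exact isClosed_eq (by fun_prop) (by fun_prop)
  | h x y =>
    rw [opTensor_incl, opTensor_incl, LinearIsometry.inner_map_map, LinearIsometry.inner_map_map]
    induction x with
    | zero => simp
    | add x x' hx hx' => simp only [map_add, inner_add_left, hx, hx']
    | tmul a b =>
      induction y with
      | zero => simp
      | add y y' hy hy' => simp only [map_add, inner_add_right, hy, hy']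
      | tmul c d =>
        simp [ContinuousLinearMap.star_eq_adjoint, ContinuousLinearMap.adjoint_inner_left]

end OpTensor

variable {A : Type u} {B : Type v} [NonUnitalCStarAlgebra A] [NonUnitalCStarAlgebra B]

/-- The linear map `π ⊗ ρ` on the algebraic tensor product, `a ⊗ b ↦ π(a) ⊗ ρ(b)`. -/
def repTensor (π : CStarRep A) (ρ : CStarRep B) :
    A ⊗[ℂ] B →ₗ[ℂ] (HilbertTensor π.space ρ.space →L[ℂ] HilbertTensor π.space ρ.space) :=
  TensorProduct.lift (LinearMap.mk₂ ℂ (fun a b => opTensor (π.hom a) (ρ.hom b))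
    (fun a a' b => by rw [map_add, opTensor_add_left])
    (fun c a b => by rw [map_smul, opTensor_smul_left])
    (fun a b b' => by rw [map_add, opTensor_add_right])
    (fun c a b => by rw [map_smul, opTensor_smul_right]))

@[simp] lemma repTensor_tmul (π : CStarRep A) (ρ : CStarRep B) (a : A) (b : B) :
    repTensor π ρ (a ⊗ₜ b) = opTensor (π.hom a) (ρ.hom b) := by
  simp [repTensor]

lemma repTensor_mul (π : CStarRep A) (ρ : CStarRep B) (x y : A ⊗[ℂ] B) :
    repTensor π ρ (x * y) = repTensor π ρ x * repTensor π ρ y := by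
  induction x with
  | zero => simp
  | add x x' hx hx' => simp only [add_mul, map_add, hx, hx']
  | tmul a b =>
    induction y with
    | zero => simp
    | add y y' hy hy' => simp only [mul_add, map_add, hy, hy']
    | tmul c d => simp [opTensor_mul]

lemma repTensor_star (π : CStarRep A) (ρ : CStarRep B) (x : A ⊗[ℂ] B) :
    repTensor π ρ (star x) = star (repTensor π ρ x) := by
  induction x with
  | zero => simp
  | add x x' hx hx' => simp only [star_add, map_add, hx, hx']
  | tmul a b => simp [map_star, opTensor_star]

lemma norm_repTensor_tmul_le (π : CStarRep A) (ρ : CStarRep B) (a : A) (b : B) :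
    ‖repTensor π ρ (a ⊗ₜ b)‖ ≤ ‖a‖ * ‖b‖ := by
  rw [repTensor_tmul]
  exact (norm_opTensor_le _ _).trans (mul_le_mul (NonUnitalStarAlgHom.norm_apply_le π.hom a)
    (NonUnitalStarAlgHom.norm_apply_le ρ.hom b) (norm_nonneg _) (norm_nonneg _))

/-- The spatial (minimal) norm on the algebraic tensor product: the supremum of `‖(π ⊗ ρ)(x)‖` over
all representations `π` of `A` and `ρ` of `B`. -/
def spatialNorm (x : A ⊗[ℂ] B) : ℝ :=
  ⨆ p : CStarRep A × CStarRep B, ‖repTensor p.1 p.2 x‖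

lemma bddAbove_repTensor (x : A ⊗[ℂ] B) :
    BddAbove (Set.range fun p : CStarRep A × CStarRep B => ‖repTensor p.1 p.2 x‖) := by
  suffices h : ∃ C : ℝ, ∀ p : CStarRep A × CStarRep B, ‖repTensor p.1 p.2 x‖ ≤ C by
    obtain ⟨C, hC⟩ := h
    exact ⟨C, by rintro _ ⟨p, rfl⟩; exact hC p⟩
  induction x with
  | zero => exact ⟨0, fun p => by simp⟩
  | tmul a b => exact ⟨_, fun p => norm_repTensor_tmul_le p.1 p.2 a b⟩
  | add x y hx hy =>
    obtain ⟨C, hC⟩ := hx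
    obtain ⟨D, hD⟩ := hy
    exact ⟨C + D, fun p => by
      rw [map_add]; exact (norm_add_le _ _).trans (add_le_add (hC p) (hD p))⟩

lemma norm_repTensor_le (π : CStarRep A) (ρ : CStarRep B) (x : A ⊗[ℂ] B) :
    ‖repTensor π ρ x‖ ≤ spatialNorm x :=
  le_ciSup (bddAbove_repTensor x) (π, ρ)

lemma spatialNorm_nonneg (x : A ⊗[ℂ] B) : 0 ≤ spatialNorm x :=
  Real.iSup_nonneg fun _ => norm_nonneg _

lemma spatialNorm_le {x : A ⊗[ℂ] B} {C : ℝ} (hC : 0 ≤ C)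
    (h : ∀ (π : CStarRep A) (ρ : CStarRep B), ‖repTensor π ρ x‖ ≤ C) : spatialNorm x ≤ C :=
  Real.iSup_le (fun p => h p.1 p.2) hC

lemma spatialNorm_mul_le (x y : A ⊗[ℂ] B) :
    spatialNorm (x * y) ≤ spatialNorm x * spatialNorm y :=
  spatialNorm_le (mul_nonneg (spatialNorm_nonneg x) (spatialNorm_nonneg y)) fun π ρ => by
    rw [repTensor_mul]
    exact (norm_mul_le _ _).trans (mul_le_mul (norm_repTensor_le π ρ x) (norm_repTensor_le π ρ y)
      (norm_nonneg _) (spatialNorm_nonneg x))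

lemma spatialNorm_mul_self_le (x : A ⊗[ℂ] B) :
    spatialNorm x * spatialNorm x ≤ spatialNorm (star x * x) := by
  have h : spatialNorm x ≤ √(spatialNorm (star x * x)) :=
    spatialNorm_le (Real.sqrt_nonneg _) fun π ρ => by
      apply Real.le_sqrt_of_sq_le
      rw [sq, ← CStarRing.norm_star_mul_self (x := repTensor π ρ x), ← repTensor_star,
        ← repTensor_mul]
      exact norm_repTensor_le π ρ _
  calc spatialNorm x * spatialNorm x
      ≤ √(spatialNorm (star x * x)) * √(spatialNorm (star x * x)) :=
        mul_le_mul h h (spatialNorm_nonneg _) (Real.sqrt_nonneg _)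
    _ = _ := Real.mul_self_sqrt (spatialNorm_nonneg _)

lemma spatialNorm_star_le (x : A ⊗[ℂ] B) : spatialNorm (star x) ≤ spatialNorm x :=
  spatialNorm_le (spatialNorm_nonneg x) fun π ρ => by
    rw [repTensor_star, norm_star]
    exact norm_repTensor_le π ρ x

lemma spatialNorm_tmul_le (a : A) (b : B) : spatialNorm (a ⊗ₜ[ℂ] b) ≤ ‖a‖ * ‖b‖ :=
  spatialNorm_le (by positivity) fun π ρ => norm_repTensor_tmul_le π ρ a b

variable (A B) in
/-- The spatial norm, bundled as a seminorm. -/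
def spatialSeminorm : Seminorm ℂ (A ⊗[ℂ] B) :=
  Seminorm.of spatialNorm
    (fun x y => spatialNorm_le (add_nonneg (spatialNorm_nonneg x) (spatialNorm_nonneg y))
      fun π ρ => by
        rw [map_add]
        exact (norm_add_le _ _).trans
          (add_le_add (norm_repTensor_le π ρ x) (norm_repTensor_le π ρ y)))
    (fun c x => by
      simp only [spatialNorm, map_smul, norm_smul]
      rw [Real.mul_iSup_of_nonneg (norm_nonneg c)])

/-! ## The minimal tensor product as a C⋆-algebra -/

variable (A B) in
/-- The algebraic tensor product, as a type synonym that carries the spatial norm. -/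
def AlgTensor : Type (max u v) := A ⊗[ℂ] B

instance : NonUnitalRing (AlgTensor A B) := inferInstanceAs (NonUnitalRing (A ⊗[ℂ] B))
instance : Module ℂ (AlgTensor A B) := inferInstanceAs (Module ℂ (A ⊗[ℂ] B))
instance : IsScalarTower ℂ (AlgTensor A B) (AlgTensor A B) :=
  inferInstanceAs (IsScalarTower ℂ (A ⊗[ℂ] B) (A ⊗[ℂ] B))
instance : SMulCommClass ℂ (AlgTensor A B) (AlgTensor A B) :=
  inferInstanceAs (SMulCommClass ℂ (A ⊗[ℂ] B) (A ⊗[ℂ] B))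
instance : StarAddMonoid (AlgTensor A B) := inferInstanceAs (StarAddMonoid (A ⊗[ℂ] B))
instance : StarModule ℂ (AlgTensor A B) := inferInstanceAs (StarModule ℂ (A ⊗[ℂ] B))

lemma star_mul_alg (x y : A ⊗[ℂ] B) : star (x * y) = star y * star x := by
  induction x with
  | zero => simp
  | add x x' hx hx' => simp only [add_mul, mul_add, star_add, hx, hx']
  | tmul a b =>
    induction y with
    | zero => simp
    | add y y' hy hy' => simp only [add_mul, mul_add, star_add, hy, hy']
    | tmul c d => simp

instance : StarRing (AlgTensor A B) where
  star_mul := star_mul_alg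
  star_add := star_add

variable (A B) in
/-- The spatial norm as a group seminorm on the type synonym. -/
def algSeminorm : AddGroupSeminorm (AlgTensor A B) := (spatialSeminorm A B).toAddGroupSeminorm

instance : NonUnitalSeminormedRing (AlgTensor A B) where
  __ := (inferInstance : NonUnitalRing (AlgTensor A B))
  __ := (algSeminorm A B).toSeminormedAddCommGroup.toPseudoMetricSpace
  norm := algSeminorm A B
  dist_eq := (algSeminorm A B).toSeminormedAddCommGroup.dist_eq
  norm_mul_le := spatialNorm_mul_le (A := A) (B := B)

lemma norm_alg (x : AlgTensor A B) : ‖x‖ = spatialNorm (A := A) (B := B) x := rfl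

instance : NormedSpace ℂ (AlgTensor A B) where
  norm_smul_le c x := (map_smul_eq_mul (spatialSeminorm A B) c x).le

instance : NormedStarGroup (AlgTensor A B) where
  norm_star_le x := spatialNorm_star_le (A := A) (B := B) x

end MinTensor

/-- The minimal (spatial) C⋆-tensor product of two C⋆-algebras: the completion of the algebraic
tensor product with respect to the spatial norm. -/
def MinTensor (A : Type u) (B : Type v) [NonUnitalCStarAlgebra A] [NonUnitalCStarAlgebra B] :
    Type (max u v) :=
  Completion (MinTensor.AlgTensor A B)

namespace MinTensor

variable {A : Type u} {B : Type v} [NonUnitalCStarAlgebra A] [NonUnitalCStarAlgebra B]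

instance : NormedAddCommGroup (MinTensor A B) :=
  inferInstanceAs (NormedAddCommGroup (Completion (AlgTensor A B)))
instance : NormedSpace ℂ (MinTensor A B) :=
  inferInstanceAs (NormedSpace ℂ (Completion (AlgTensor A B)))
instance : CompleteSpace (MinTensor A B) :=
  inferInstanceAs (CompleteSpace (Completion (AlgTensor A B)))

variable (A B) in
/-- The canonical map from the algebraic tensor product to its completion. -/
def incl : AlgTensor A B →ₗᵢ[ℂ] MinTensor A B := Completion.toComplₗᵢ

lemma denseRange_incl : DenseRange (incl A B) := Completion.denseRange_coe

/-- The extension of a bounded operator on the algebraic tensor product to the completion. -/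
def extend (f : AlgTensor A B →L[ℂ] AlgTensor A B) : MinTensor A B →L[ℂ] MinTensor A B :=
  f.completion

@[simp] lemma extend_incl (f : AlgTensor A B →L[ℂ] AlgTensor A B) (x : AlgTensor A B) :
    extend f (incl A B x) = incl A B (f x) :=
  ContinuousLinearMap.completion_apply_coe _ _

lemma ext_incl' {F G : MinTensor A B →L[ℂ] MinTensor A B}
    (h : ∀ x, F (incl A B x) = G (incl A B x)) : F = G := by
  ext x
  exact congrFun (denseRange_incl.equalizer F.continuous G.continuous (funext h)) x

lemma norm_extend_le (f : AlgTensor A B →L[ℂ] AlgTensor A B) {C : ℝ} (hC : 0 ≤ C)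
    (h : ∀ x, ‖f x‖ ≤ C * ‖x‖) : ‖extend f‖ ≤ C := by
  refine ContinuousLinearMap.opNorm_le_bound _ hC fun x => ?_
  induction x using denseRange_incl.induction_on with
  | hp => exact isClosed_le (by fun_prop) (by fun_prop)
  | ih x =>
    rw [extend_incl, LinearIsometry.norm_map, LinearIsometry.norm_map]
    exact h x

variable (A B) in
/-- The multiplication of the algebraic tensor product, extended in the right variable. -/
def preMul : AlgTensor A B →L[ℂ] (MinTensor A B →L[ℂ] MinTensor A B) :=
  LinearMap.mkContinuous
    { toFun := fun x => extend (ContinuousLinearMap.mul ℂ (AlgTensor A B) x)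
      map_add' := fun x y => ext_incl' fun z => by
        change _ = extend _ _ + extend _ _
        simp
      map_smul' := fun c x => ext_incl' fun z => by
        change _ = c • extend _ _
        simp }
    1 fun x => by
      rw [one_mul]
      exact norm_extend_le _ (norm_nonneg x) fun y => norm_mul_le x y

variable (A B) in
/-- The multiplication of the minimal tensor product. -/
def mulL : MinTensor A B →L[ℂ] (MinTensor A B →L[ℂ] MinTensor A B) :=
  (preMul A B).fromCompletion

variable (A B) in
/-- The involution of the minimal tensor product. -/
def starL : MinTensor A B →L⋆[ℂ] MinTensor A B :=
  (((starₗᵢ ℂ : AlgTensor A B ≃ₗᵢ⋆[ℂ] AlgTensor A B).toContinuousLinearEquiv :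
    AlgTensor A B →L⋆[ℂ] AlgTensor A B)).completion

instance : Mul (MinTensor A B) := ⟨fun x y => mulL A B x y⟩
instance : Star (MinTensor A B) := ⟨starL A B⟩

lemma incl_mul (x y : AlgTensor A B) : incl A B (x * y) = incl A B x * incl A B y := by
  change _ = mulL A B (incl A B x) (incl A B y)
  have h : mulL A B (incl A B x) = preMul A B x :=
    ContinuousLinearMap.fromCompletion_apply_coe (preMul A B) x
  rw [h]
  exact (extend_incl (ContinuousLinearMap.mul ℂ (AlgTensor A B) x) y).symm

lemma incl_star (x : AlgTensor A B) : incl A B (star x) = star (incl A B x) :=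
  (ContinuousLinearMap.completion_apply_coe
    (((starₗᵢ ℂ : AlgTensor A B ≃ₗᵢ⋆[ℂ] AlgTensor A B).toContinuousLinearEquiv :
      AlgTensor A B →L⋆[ℂ] AlgTensor A B)) x).symm

instance : ContinuousMul (MinTensor A B) where
  continuous_mul := by
    change Continuous fun p : MinTensor A B × MinTensor A B => mulL A B p.1 p.2
    fun_prop

instance : ContinuousStar (MinTensor A B) where
  continuous_star := (starL A B).continuous

instance : NonUnitalRing (MinTensor A B) where
  __ := (inferInstance : AddCommGroup (MinTensor A B))
  __ := (inferInstance : Mul (MinTensor A B))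
  left_distrib x y z := map_add (mulL A B x) y z
  right_distrib x y z := congrArg (fun f => f z) (map_add (mulL A B) x y)
  zero_mul x := congrArg (fun f => f x) (map_zero (mulL A B))
  mul_zero x := map_zero (mulL A B x)
  mul_assoc x y z := by
    induction x, y, z using denseRange_incl.induction_on₃ with
    | hp => exact isClosed_eq (by fun_prop) (by fun_prop)
    | h x y z => simp only [← incl_mul, mul_assoc]

instance : NonUnitalNormedRing (MinTensor A B) where
  __ := (inferInstance : NormedAddCommGroup (MinTensor A B))
  __ := (inferInstance : NonUnitalRing (MinTensor A B))
  norm_mul_le x y := by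
    induction x, y using denseRange_incl.induction_on₂ with
    | hp => exact isClosed_le (by fun_prop) (by fun_prop)
    | h x y =>
      simp only [← incl_mul, LinearIsometry.norm_map]
      exact norm_mul_le x y

instance : StarRing (MinTensor A B) where
  star_involutive x := by
    induction x using denseRange_incl.induction_on with
    | hp => exact isClosed_eq (by fun_prop) (by fun_prop)
    | ih x => rw [← incl_star, ← incl_star, star_star]
  star_mul x y := by
    induction x, y using denseRange_incl.induction_on₂ with
    | hp => exact isClosed_eq (by fun_prop) (by fun_prop)
    | h x y => simp only [← incl_mul, ← incl_star, star_mul]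
  star_add x y := map_add (starL A B) x y

/-- The minimal tensor product of two C⋆-algebras is a C⋆-algebra. -/
instance : NonUnitalCStarAlgebra (MinTensor A B) where
  norm_mul_self_le x := by
    induction x using denseRange_incl.induction_on with
    | hp => exact isClosed_le (by fun_prop) (by fun_prop)
    | ih x =>
      simp only [← incl_star, ← incl_mul, LinearIsometry.norm_map]
      exact spatialNorm_mul_self_le (A := A) (B := B) x
  smul_assoc c x y := congrArg (fun f => f y) (map_smul (mulL A B) c x)
  smul_comm c x y := (map_smul (mulL A B x) c y).symm
  star_smul c x := (starL A B).map_smulₛₗ c x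

/-- The elementary tensor `a ⊗ b` in the minimal tensor product. -/
def tmul (a : A) (b : B) : MinTensor A B := incl A B (a ⊗ₜ[ℂ] b : A ⊗[ℂ] B)

lemma tmul_mul_tmul (a a' : A) (b b' : B) :
    tmul a b * tmul a' b' = tmul (a * a') (b * b') := by
  refine (incl_mul (A := A) (B := B) _ _).symm.trans (congrArg (incl A B) ?_)
  exact Algebra.TensorProduct.tmul_mul_tmul a a' b b'

lemma star_tmul (a : A) (b : B) : star (tmul a b) = tmul (star a) (star b) :=
  (incl_star (A := A) (B := B) _).symm

lemma repTensor_map_left (π : CStarRep A) (ρ : CStarRep B) (b : B) (x : A ⊗[ℂ] B) :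
    repTensor π ρ (LinearMap.lTensor A (LinearMap.mulLeft ℂ b) x) =
      opTensor 1 (ρ.hom b) * repTensor π ρ x := by
  induction x with
  | zero => simp
  | add x y hx hy => simp only [map_add, mul_add, hx, hy]
  | tmul a c => simp [← opTensor_mul]

lemma repTensor_map_right (π : CStarRep A) (ρ : CStarRep B) (b : B) (x : A ⊗[ℂ] B) :
    repTensor π ρ (LinearMap.lTensor A (LinearMap.mulRight ℂ b) x) =
      repTensor π ρ x * opTensor 1 (ρ.hom b) := by
  induction x with
  | zero => simp
  | add x y hx hy => simp only [map_add, add_mul, hx, hy]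
  | tmul a c => simp [← opTensor_mul]

lemma norm_opTensor_one_le (π : CStarRep A) (ρ : CStarRep B) (b : B) :
    ‖opTensor (1 : π.space →L[ℂ] π.space) (ρ.hom b)‖ ≤ ‖b‖ := by
  refine (norm_opTensor_le _ _).trans ?_
  calc ‖(1 : π.space →L[ℂ] π.space)‖ * ‖ρ.hom b‖ ≤ 1 * ‖b‖ :=
        mul_le_mul ContinuousLinearMap.norm_id_le (NonUnitalStarAlgHom.norm_apply_le ρ.hom b)
          (norm_nonneg _) zero_le_one
    _ = ‖b‖ := one_mul _

lemma spatialNorm_map_left (b : B) (x : A ⊗[ℂ] B) :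
    spatialNorm (LinearMap.lTensor A (LinearMap.mulLeft ℂ b) x) ≤ ‖b‖ * spatialNorm x :=
  spatialNorm_le (mul_nonneg (norm_nonneg b) (spatialNorm_nonneg x)) fun π ρ => by
    rw [repTensor_map_left]
    exact (norm_mul_le _ _).trans (mul_le_mul (norm_opTensor_one_le π ρ b)
      (norm_repTensor_le π ρ x) (norm_nonneg _) (norm_nonneg _))

lemma spatialNorm_map_right (b : B) (x : A ⊗[ℂ] B) :
    spatialNorm (LinearMap.lTensor A (LinearMap.mulRight ℂ b) x) ≤ ‖b‖ * spatialNorm x :=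
  spatialNorm_le (mul_nonneg (norm_nonneg b) (spatialNorm_nonneg x)) fun π ρ => by
    rw [repTensor_map_right, mul_comm ‖b‖]
    exact (norm_mul_le _ _).trans (mul_le_mul (norm_repTensor_le π ρ x)
      (norm_opTensor_one_le π ρ b) (norm_nonneg _) (spatialNorm_nonneg _))

/-- Left multiplication by `1 ⊗ b` on the algebraic tensor product, `a ⊗ c ↦ a ⊗ bc`. -/
def oneTmulLeft (b : B) : AlgTensor A B →L[ℂ] AlgTensor A B :=
  LinearMap.mkContinuous
    (LinearMap.lTensor A (LinearMap.mulLeft ℂ b) : A ⊗[ℂ] B →ₗ[ℂ] A ⊗[ℂ] B) ‖b‖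
    (spatialNorm_map_left (A := A) b)

/-- Right multiplication by `1 ⊗ b` on the algebraic tensor product, `a ⊗ c ↦ a ⊗ cb`. -/
def oneTmulRight (b : B) : AlgTensor A B →L[ℂ] AlgTensor A B :=
  LinearMap.mkContinuous
    (LinearMap.lTensor A (LinearMap.mulRight ℂ b) : A ⊗[ℂ] B →ₗ[ℂ] A ⊗[ℂ] B) ‖b‖
    (spatialNorm_map_right (A := A) b)

lemma oneTmul_central_alg (b : B) (x y : A ⊗[ℂ] B) :
    (LinearMap.lTensor A (LinearMap.mulRight ℂ b) x) * y =
      x * (LinearMap.lTensor A (LinearMap.mulLeft ℂ b) y) := by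
  induction x with
  | zero => simp
  | add x x' hx hx' => simp only [map_add, add_mul, hx, hx']
  | tmul a c =>
    induction y with
    | zero => simp
    | add y y' hy hy' => simp only [map_add, mul_add, hy, hy']
    | tmul a' c' => simp [mul_assoc]

variable (A) in
/-- The multiplier `1 ⊗ b` of the minimal tensor product. -/
def oneTmul (b : B) : 𝓜(ℂ, MinTensor A B) where
  fst := extend (oneTmulLeft b)
  snd := extend (oneTmulRight b)
  central x y := by
    induction x, y using denseRange_incl.induction_on₂ with
    | hp => exact isClosed_eq (by fun_prop) (by fun_prop)
    | h x y =>
      simp only [extend_incl, ← incl_mul]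
      exact congrArg _ (oneTmul_central_alg b x y)

/-- The multiplier `1 ⊗ b` acts on the left by `a ⊗ c ↦ a ⊗ bc`. -/
lemma oneTmul_fst_tmul (b : B) (a : A) (c : B) :
    (oneTmul A b).fst (tmul a c) = tmul a (b * c) :=
  extend_incl _ _

/-- The multiplier `1 ⊗ b` acts on the right by `a ⊗ c ↦ a ⊗ cb`. -/
lemma oneTmul_snd_tmul (b : B) (a : A) (c : B) :
    (oneTmul A b).snd (tmul a c) = tmul a (c * b) :=
  extend_incl _ _

end MinTensor

/-! ## The strict topology and slice maps -/

/-- The strict topology on the multiplier algebra `M(A)`: the coarsest topology for which the maps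
`x ↦ xa` and `x ↦ ax` from `M(A)` to `A` are norm continuous for all `a` in `A`.  For a double
centralizer `x`, these products are `x.fst a = xa` and `x.snd a = ax`. -/
abbrev strictTopology (A : Type u) [NonUnitalCStarAlgebra A] : TopologicalSpace 𝓜(ℂ, A) :=
  (⨅ a : A, TopologicalSpace.induced (fun x : 𝓜(ℂ, A) => x.fst a) inferInstance) ⊓
    (⨅ a : A, TopologicalSpace.induced (fun x : 𝓜(ℂ, A) => x.snd a) inferInstance)

/-- A map between multiplier algebras is strictly continuous on the (closed) unit ball. -/
def StrictlyContinuousOnUnitBall {A : Type u} {B : Type v} [NonUnitalCStarAlgebra A]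
    [NonUnitalCStarAlgebra B] (Φ : 𝓜(ℂ, A) → 𝓜(ℂ, B)) : Prop :=
  @ContinuousOn _ _ (strictTopology A) (strictTopology B) Φ (Metric.closedBall 0 1)

section Slice

variable {A : Type u} {B : Type v} [NonUnitalCStarAlgebra A] [NonUnitalCStarAlgebra B]

/-- `S` is the slice map `ω ⊗ ι`: the bounded linear map with `a ⊗ b ↦ ω(a) b`. -/
def IsSliceMap (ω : StrongDual ℂ A) (S : MinTensor A B →L[ℂ] B) : Prop :=
  ∀ (a : A) (b : B), S (MinTensor.tmul a b) = ω a • b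

/-- `Φ` is a bounded linear extension of `S` to the multiplier algebras that is strictly continuous
on the unit ball. -/
structure IsStrictExtension (S : MinTensor A B →L[ℂ] B)
    (Φ : 𝓜(ℂ, MinTensor A B) →L[ℂ] 𝓜(ℂ, B)) : Prop where
  extends_map : ∀ x : MinTensor A B, Φ (x : 𝓜(ℂ, MinTensor A B)) = (S x : 𝓜(ℂ, B))
  strict : StrictlyContinuousOnUnitBall Φ

end Slice

end

/-! Formally (ω ⊗ ι)(x)b is (ω ⊗ ι)(x(1 ⊗ b)), and 1 ⊗ b is approximated by e ⊗ b with e in an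
approximate unit of A. The proof rests on one estimate that makes this precise: if S is the slice
map, the operators y ↦ S(y)b - S(y(e ⊗ b)) and y ↦ bS(y) - S((e ⊗ b)y) tend to 0 in operator norm
(`exists_isSliceMap_tendsto_defect`).

By linearity the estimate is needed only for ω = ⟪ξ, π(·)ξ⟫ with π(e)ξ → ξ. Such functionals span A*
(`StrongDual.induction_on_vector`): Hahn–Banach writes a hermitian functional as a difference of
positive ones, and GNS represents these by vectors. For such ω the first operator is the slice by
⟪ξ, π(·)(ξ - π(e)ξ)⟫ followed by right multiplication by b. It is therefore small once slices by ⟪ξ,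
π(·)η⟫ are bounded by a constant times ‖ξ‖‖η‖ (`exists_norm_algSlice_coeff_le`). Paired with vector
functionals of B, that bound comes from the definition of the spatial norm; since these span B*,
uniform boundedness turns it into a norm bound.

The extension Φ(x) is the strict limit of S(fx), with f in the approximate unit of A ⊗ B
(`exists_strictLimit_map`). The limit exists because S(fx)b is uniformly close to S(fx(e ⊗ b)),
which converges. Likewise Φ(x)b is uniformly close to S(x(e ⊗ b)) for x in the unit ball, whence
strict continuity there. Uniqueness holds because fx → x strictly within the ball when ‖x‖ ≤ 1. The
module identities follow from Φ(x)b = lim S(x(e ⊗ b)) and its left analogue. -/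

section Functionals

universe u

open Filter Topology
open scoped ComplexOrder InnerProductSpace ComplexStarModule

attribute [local instance] CStarAlgebra.spectralOrder CStarAlgebra.spectralOrderedRing

variable {A : Type u} [NonUnitalCStarAlgebra A]

/-! ### Decomposition of hermitian functionals into positive ones -/

namespace CStarAlgebra

/-- The norms of the positive elements that dominate the real part of `a`. -/
def dominatingNorms (a : A) : Set ℝ := {r | ∃ c : A, 0 ≤ c ∧ (ℜ a : A) ≤ c ∧ ‖c‖ = r}

lemma dominatingNorms_nonempty (a : A) : (dominatingNorms a).Nonempty :=
  ⟨_, (ℜ a : A)⁺, CFC.posPart_nonneg _, CFC.le_posPart (ℜ a).2, rfl⟩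

lemma bddBelow_dominatingNorms (a : A) : BddBelow (dominatingNorms a) :=
  ⟨0, by rintro _ ⟨c, -, -, rfl⟩; exact norm_nonneg c⟩

/-- The infimum of the norms of the positive elements that dominate the real part of `a`. -/
noncomputable def posGauge (a : A) : ℝ := sInf (dominatingNorms a)

lemma posGauge_le {a c : A} (hc : 0 ≤ c) (h : (ℜ a : A) ≤ c) : posGauge a ≤ ‖c‖ :=
  csInf_le (bddBelow_dominatingNorms a) ⟨c, hc, h, rfl⟩

lemma exists_dominating (a : A) {ε : ℝ} (hε : 0 < ε) :
    ∃ c : A, 0 ≤ c ∧ (ℜ a : A) ≤ c ∧ ‖c‖ < posGauge a + ε := by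
  obtain ⟨_, ⟨c, hc, h, rfl⟩, hlt⟩ := exists_lt_of_csInf_lt (dominatingNorms_nonempty a)
    (lt_add_of_pos_right (sInf (dominatingNorms a)) hε)
  exact ⟨c, hc, h, hlt⟩

lemma posGauge_add_le (a b : A) : posGauge (a + b) ≤ posGauge a + posGauge b := by
  refine le_of_forall_pos_le_add fun ε hε => ?_
  obtain ⟨c, hc, hac, hcn⟩ := exists_dominating a (half_pos hε)
  obtain ⟨d, hd, hbd, hdn⟩ := exists_dominating b (half_pos hε)
  have h : posGauge (a + b) ≤ ‖c + d‖ :=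
    posGauge_le (add_nonneg hc hd) (by rw [map_add]; exact add_le_add hac hbd)
  linarith [norm_add_le c d]

lemma posGauge_smul_le {t : ℝ} (ht : 0 < t) (a : A) : posGauge (t • a) ≤ t * posGauge a := by
  refine le_of_forall_pos_le_add fun ε hε => ?_
  obtain ⟨c, hc, hac, hcn⟩ := exists_dominating a (div_pos hε ht)
  have h : posGauge (t • a) ≤ ‖t • c‖ :=
    posGauge_le (smul_nonneg ht.le hc) (by
      rw [map_smul]; exact smul_le_smul_of_nonneg_left hac ht.le)
  rw [norm_smul, Real.norm_of_nonneg ht.le] at h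
  calc posGauge (t • a) ≤ t * ‖c‖ := h
    _ ≤ t * (posGauge a + ε / t) := by gcongr
    _ = t * posGauge a + ε := by field_simp

lemma posGauge_smul {t : ℝ} (ht : 0 < t) (a : A) : posGauge (t • a) = t * posGauge a := by
  refine le_antisymm (posGauge_smul_le ht a) ?_
  have h := posGauge_smul_le (inv_pos.2 ht) (t • a)
  rw [inv_smul_smul₀ ht.ne'] at h
  calc t * posGauge a ≤ t * (t⁻¹ * posGauge (t • a)) := by gcongr
    _ = posGauge (t • a) := by field_simp

lemma posGauge_nonpos {a : A} (h : (ℜ a : A) ≤ 0) : posGauge a ≤ 0 := by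
  simpa using posGauge_le le_rfl h

/-- If ℜa ≤ c and -ℜa ≤ d, then 0 ≤ ℜa + d ≤ c + d, so ‖ℜa‖ ≤ ‖c + d‖ + ‖d‖. This is what makes a
bounded functional dominated by the gauge on the antidiagonal of A × A. -/
lemma norm_realPart_le_posGauge (a : A) :
    ‖(ℜ a : A)‖ ≤ 2 * (posGauge a + posGauge (-a)) := by
  refine le_of_forall_pos_le_add fun ε hε => ?_
  obtain ⟨c, hc, hac, hcn⟩ := exists_dominating a (show 0 < ε / 4 by positivity)
  obtain ⟨d, hd, had, hdn⟩ := exists_dominating (-a) (show 0 < ε / 4 by positivity)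
  rw [map_neg, AddSubgroup.coe_neg, neg_le_iff_add_nonneg'] at had
  have h : ‖(ℜ a : A) + d‖ ≤ ‖c + d‖ :=
    CStarAlgebra.norm_le_norm_of_nonneg_of_le had (by gcongr)
  have h' : ‖(ℜ a : A)‖ ≤ ‖(ℜ a : A) + d‖ + ‖d‖ := by
    simpa using norm_sub_le ((ℜ a : A) + d) d
  linarith [norm_add_le c d, norm_nonneg c]

/-- A real functional that is dominated by a multiple of `posGauge` is the real part of a positive
complex functional. -/
lemma exists_positive_of_le_posGauge {K : ℝ} (hK : 0 ≤ K) (φ : A →ₗ[ℝ] ℝ)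
    (h : ∀ a, φ a ≤ K * posGauge a) : ∃ f : A →ₚ[ℂ] ℂ, ∀ a, (f a).re = φ a := by
  -- Domination by the gauge makes φ nonpositive wherever the real part is nonpositive. For a ≥ 0
  -- this applies to -a and to both ±ia, whose real part is 0; hence φ(a) ≥ 0 and φ(ia) = 0.
  have h0 : ∀ a : A, (ℜ a : A) ≤ 0 → φ a ≤ 0 := fun a ha =>
    (h a).trans (mul_nonpos_of_nonneg_of_nonpos hK (posGauge_nonpos ha))
  let f : A →ₗ[ℂ] ℂ := Module.Dual.extendRCLike (𝕜 := ℂ) φ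
  have hf : ∀ a, f a = φ a - Complex.I * φ (Complex.I • a) := fun a =>
    Module.Dual.extendRCLike_apply (𝕜 := ℂ) φ a
  refine ⟨PositiveLinearMap.mk₀ f fun a ha => ?_, fun a => ?_⟩
  · have hre : (ℜ a : A) = a := (IsSelfAdjoint.of_nonneg ha).coe_realPart
    have him : ℜ (Complex.I • a) = 0 := by
      rw [realPart_I_smul, (IsSelfAdjoint.of_nonneg ha).imaginaryPart, neg_zero]
    have h1 : 0 ≤ φ a := by
      have := h0 (-a) (by rw [map_neg, AddSubgroup.coe_neg, hre]; simpa using ha)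
      rw [map_neg] at this; linarith
    have h2 : φ (Complex.I • a) = 0 := by
      have h3 := h0 (Complex.I • a) (by rw [him]; simp)
      have h4 := h0 (-(Complex.I • a)) (by rw [map_neg, him]; simp)
      rw [map_neg] at h4; linarith
    rw [hf, h2]
    simpa using h1
  · change (f a).re = _
    simp [hf]

/-- A bounded functional with `ω(a⋆) = conj ω(a)` is a difference of positive functionals. -/
lemma exists_positive_sub_positive (ω : StrongDual ℂ A) (hω : ∀ a, ω (star a) = conj (ω a)) :
    ∃ f g : A →ₚ[ℂ] ℂ, ∀ a, ω a = f a - g a := by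
  let r : A →ₗ[ℝ] ℝ := Complex.reLm ∘ₗ ω.toLinearMap.restrictScalars ℝ
  have hr : ∀ a, r a = (ω a).re := fun a => rfl
  -- Hermitian symmetry enters here: the gauge sees only ℜa, so r has to depend on ℜa alone.
  have hre : ∀ a : A, r a = r (ℜ a : A) := fun a => by
    rw [hr, hr, realPart_apply_coe, ← Complex.coe_smul, map_smul, map_add, hω]
    simp
    ring
  let N : A × A → ℝ := fun p => 2 * ‖ω‖ * (posGauge p.1 + posGauge p.2)
  -- The functional (a, -a) ↦ Re ω(a) on the antidiagonal. The two coordinate restrictions of a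
  -- dominated extension g are the positive parts sought, since g(a, -a) = g(a, 0) - g(0, a).
  let F : (A × A) →ₗ.[ℝ] ℝ :=
    { domain := LinearMap.ker (LinearMap.fst ℝ A A + LinearMap.snd ℝ A A)
      toFun := r ∘ₗ LinearMap.fst ℝ A A ∘ₗ Submodule.subtype _ }
  obtain ⟨g, hgF, hgN⟩ := exists_extension_of_le_sublinear F N
    (fun c hc x => by simp only [N, Prod.smul_fst, Prod.smul_snd, posGauge_smul hc]; ring)
    (fun x y => by
      have h1 := posGauge_add_le x.1 y.1
      have h2 := posGauge_add_le x.2 y.2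
      have h3 : posGauge (x.1 + y.1) + posGauge (x.2 + y.2)
        ≤ (posGauge x.1 + posGauge x.2) + (posGauge y.1 + posGauge y.2) := by linarith
      have := mul_le_mul_of_nonneg_left h3 (show 0 ≤ 2 * ‖ω‖ by positivity)
      simp only [N, Prod.fst_add, Prod.snd_add]
      linarith)
    (fun x => by
      have hx : x.1.1 + x.1.2 = 0 := x.2
      change r x.1.1 ≤ 2 * ‖ω‖ * (posGauge x.1.1 + posGauge x.1.2)
      rw [eq_neg_of_add_eq_zero_right hx, hre]
      calc r (ℜ x.1.1 : A) ≤ ‖ω (ℜ x.1.1 : A)‖ := Complex.re_le_norm _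
        _ ≤ ‖ω‖ * ‖(ℜ x.1.1 : A)‖ := ω.le_opNorm _
        _ ≤ ‖ω‖ * (2 * (posGauge x.1.1 + posGauge (-x.1.1))) := by
          gcongr; exact norm_realPart_le_posGauge _
        _ = _ := by ring)
  have h0 : posGauge (0 : A) ≤ 0 := posGauge_nonpos (by simp)
  have hK : 0 ≤ 2 * ‖ω‖ := by positivity
  obtain ⟨f₁, hf₁⟩ := exists_positive_of_le_posGauge hK (g ∘ₗ LinearMap.inl ℝ A A) fun a =>
    (hgN (a, 0)).trans (mul_le_mul_of_nonneg_left (by simpa using h0) hK)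
  obtain ⟨f₂, hf₂⟩ := exists_positive_of_le_posGauge hK (g ∘ₗ LinearMap.inr ℝ A A) fun a =>
    (hgN (0, a)).trans (mul_le_mul_of_nonneg_left (by simpa using h0) hK)
  have hreal : ∀ a, (ω a).re = (f₁ a).re - (f₂ a).re := fun a => by
    have := hgF ⟨(a, -a), LinearMap.mem_ker.2 (add_neg_cancel a)⟩
    rw [hf₁, hf₂, ← hr]
    change _ = g (a, 0) - g (0, a)
    rw [← map_sub, Prod.mk_sub_mk, sub_zero, zero_sub]
    exact this.symm
  refine ⟨f₁, f₂, fun a => Complex.ext (by simpa using hreal a) ?_⟩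
  -- The imaginary parts follow from the real parts at ia.
  have := hreal (Complex.I • a)
  simp only [map_smul, smul_eq_mul, Complex.I_mul_re] at this
  rw [Complex.sub_im]
  linarith

/-! ### GNS vectors without a unit -/

variable (f : A →ₚ[ℂ] ℂ)

lemma exists_norm_toPreGNS_le : ∃ C : ℝ, ∀ a : A, ‖f.toPreGNS a‖ ≤ C * ‖a‖ := by
  obtain ⟨K, hK⟩ := f.exists_norm_apply_le
  refine ⟨√K, fun a => ?_⟩
  rw [PositiveLinearMap.preGNS_norm_def, PositiveLinearMap.ofPreGNS_toPreGNS]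
  apply Real.sqrt_le_iff.2 ⟨by positivity, ?_⟩
  rw [mul_pow, Real.sq_sqrt K.coe_nonneg, sq ‖a‖, ← CStarRing.norm_star_mul_self (x := a)]
  exact (Complex.re_le_norm _).trans (hK _)

/-- An approximate unit replaces 1 in Cauchy–Schwarz: f(ea) = ⟪e, a⟫, and the GNS seminorm of e
stays bounded. The bound lets f descend to a bounded functional on the GNS space. -/
lemma exists_norm_apply_le_norm_toPreGNS : ∃ C : ℝ, ∀ a : A, ‖f a‖ ≤ C * ‖f.toPreGNS a‖ := by
  obtain ⟨C, hC⟩ := exists_norm_toPreGNS_le f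
  have hu := increasingApproximateUnit A
  refine ⟨|C|, fun a => ?_⟩
  have ht : Tendsto (fun e : A => ‖f (e * a)‖) (approximateUnit A) (𝓝 ‖f a‖) :=
    ((map_continuous f).norm.tendsto a).comp (hu.tendsto_mul_right a)
  refine le_of_tendsto ht ?_
  filter_upwards [hu.eventually_norm, hu.eventually_star_eq] with e he hs
  have h : f (e * a) = ⟪f.toPreGNS e, f.toPreGNS a⟫_ℂ := by
    rw [PositiveLinearMap.preGNS_inner_def]
    simp [hs]
  rw [h]
  refine (norm_inner_le_norm _ _).trans (mul_le_mul_of_nonneg_right ?_ (norm_nonneg _))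
  calc _ ≤ C * ‖e‖ := hC e
    _ ≤ |C| * 1 := by gcongr; exact le_abs_self C
    _ = |C| := mul_one _

/-- The cyclic vector of the GNS representation. -/
lemma exists_gns_cyclic_vector :
    ∃ ξ : f.GNS, ∀ a : A, f.gnsNonUnitalStarAlgHom a ξ = (f.toPreGNS a : f.GNS) ∧
      f a = ⟪ξ, f.gnsNonUnitalStarAlgHom a ξ⟫_ℂ := by
  obtain ⟨C, hC⟩ := exists_norm_apply_le_norm_toPreGNS f
  let g : f.PreGNS →L[ℂ] ℂ :=
    LinearMap.mkContinuous (f.toLinearMap ∘ₗ f.ofPreGNS.toLinearMap) C fun x => hC (f.ofPreGNS x)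
  -- The cyclic vector is the Riesz representative of f. It satisfies π(a)ξ = a because ⟪π(a)ξ, y⟫ =
  -- ⟪ξ, a⋆y⟫ = f(a⋆y) = ⟪a, y⟫.
  let ξ : f.GNS := (InnerProductSpace.toDual ℂ f.GNS).symm g.fromCompletion
  have hξ : ∀ a : A, ⟪ξ, (f.toPreGNS a : f.GNS)⟫_ℂ = f a := fun a => by
    rw [InnerProductSpace.toDual_symm_apply, ContinuousLinearMap.fromCompletion_apply_coe]
    rfl
  have hact : ∀ a : A, f.gnsNonUnitalStarAlgHom a ξ = (f.toPreGNS a : f.GNS) := fun a => by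
    refine ext_inner_right ℂ fun y => ?_
    induction y using Completion.induction_on with
    | hp => exact isClosed_eq (by fun_prop) (by fun_prop)
    | ih y =>
      rw [← ContinuousLinearMap.adjoint_inner_right, ← ContinuousLinearMap.star_eq_adjoint,
        ← map_star, f.gnsNonUnitalStarAlgHom_apply_coe, Completion.inner_coe,
        PositiveLinearMap.preGNS_inner_def]
      exact hξ (star a * f.ofPreGNS y)
  exact ⟨ξ, fun a => ⟨hact a, by rw [hact, hξ]⟩⟩

end CStarAlgebra

/-! ### Spanning the dual by vector functionals -/

open CStarAlgebra

/-- The vector `ξ` is nondegenerate for the representation `π`. -/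
def CStarRep.IsNondegenerateVector (π : CStarRep A) (ξ : π.space) : Prop :=
  Tendsto (fun e => π.hom e ξ) (approximateUnit A) (𝓝 ξ)

lemma CStarRep.norm_apply_le (π : CStarRep A) (a : A) (ξ : π.space) :
    ‖π.hom a ξ‖ ≤ ‖a‖ * ‖ξ‖ :=
  (ContinuousLinearMap.le_opNorm _ _).trans
    (mul_le_mul_of_nonneg_right (NonUnitalStarAlgHom.norm_apply_le π.hom a) (norm_nonneg ξ))

/-- Every positive functional is a vector functional. -/
lemma exists_cstarRep_vector (f : A →ₚ[ℂ] ℂ) :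
    ∃ (π : CStarRep A) (ξ : π.space), π.IsNondegenerateVector ξ ∧
      ∀ a, f a = ⟪ξ, π.hom a ξ⟫_ℂ := by
  obtain ⟨ξ, hξ⟩ := exists_gns_cyclic_vector f
  obtain ⟨C, hC⟩ := exists_norm_toPreGNS_le f
  let π : CStarRep A := { space := f.GNS, hom := f.gnsNonUnitalStarAlgHom }
  refine ⟨π, ξ, ?_, fun a => (hξ a).2⟩
  have hu := increasingApproximateUnit A
  -- This set contains the dense image of A, since A → GNS is bounded and ea → a. A three-epsilon
  -- argument with ‖e‖ ≤ 1 then reaches ξ.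
  let S : Set f.GNS := {η | Tendsto (fun e => π.hom e η) (approximateUnit A) (𝓝 η)}
  have hcoe : ∀ y : f.PreGNS, (y : f.GNS) ∈ S := fun y => by
    let T : A →L[ℂ] f.GNS :=
      Completion.toComplL.comp (LinearMap.mkContinuous f.toPreGNS.toLinearMap C hC)
    have hT := (T.continuous.tendsto (f.ofPreGNS y)).comp (hu.tendsto_mul_right (f.ofPreGNS y))
    refine hT.congr fun e => ?_
    exact (f.gnsNonUnitalStarAlgHom_apply_coe (a := e) (b := y)).symm
  change ξ ∈ S
  refine Metric.tendsto_nhds.2 fun ε hε => ?_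
  obtain ⟨y, hy⟩ := Completion.denseRange_coe.exists_dist_lt ξ (show 0 < ε / 3 by positivity)
  filter_upwards [Metric.tendsto_nhds.1 (hcoe y) (ε / 3) (by positivity), hu.eventually_norm]
    with e he hn
  have h1 : dist (π.hom e ξ) (π.hom e (y : f.GNS)) < ε / 3 := by
    rw [dist_eq_norm, ← map_sub]
    refine (π.norm_apply_le e _).trans_lt ?_
    rw [dist_eq_norm] at hy
    exact (mul_le_of_le_one_left (norm_nonneg _) hn).trans_lt hy
  rw [dist_comm] at hy
  linarith [dist_triangle4 (π.hom e ξ) (π.hom e (y : f.GNS)) (y : f.GNS) ξ]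

/-- Every bounded functional is a linear combination of vector functionals. -/
theorem StrongDual.induction_on_vector {P : StrongDual ℂ A → Prop}
    (add : ∀ φ ψ, P φ → P ψ → P (φ + ψ)) (smul : ∀ (c : ℂ) φ, P φ → P (c • φ))
    (vector : ∀ (π : CStarRep A) (ξ : π.space), π.IsNondegenerateVector ξ →
      ∀ φ : StrongDual ℂ A, (∀ a, φ a = ⟪ξ, π.hom a ξ⟫_ℂ) → P φ)
    (ω : StrongDual ℂ A) : P ω := by
  have hpos : ∀ (f : A →ₚ[ℂ] ℂ) (φ : StrongDual ℂ A), (∀ a, φ a = f a) → P φ := fun f φ h => by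
    obtain ⟨π, ξ, hξ, hf⟩ := exists_cstarRep_vector f
    exact vector π ξ hξ φ fun a => (h a).trans (hf a)
  have hherm : ∀ φ : StrongDual ℂ A, (∀ a, φ (star a) = conj (φ a)) → P φ := fun φ h => by
    obtain ⟨f, g, hfg⟩ := exists_positive_sub_positive φ h
    let f' : StrongDual ℂ A := ⟨f.toLinearMap, map_continuous f⟩
    let g' : StrongDual ℂ A := ⟨g.toLinearMap, map_continuous g⟩
    have : φ = f' + (-1 : ℂ) • g' := by
      ext a
      rw [hfg a, sub_eq_add_neg, ← neg_one_mul]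
      rfl
    rw [this]
    exact add _ _ (hpos f f' fun _ => rfl) (smul _ _ (hpos g g' fun _ => rfl))
  let ωs : StrongDual ℂ A :=
    LinearMap.mkContinuous
      { toFun := fun a => conj (ω (star a))
        map_add' := fun a b => by simp
        map_smul' := fun c a => by simp } ‖ω‖
      fun a => by simpa using ω.le_opNorm (star a)
  have hωs : ∀ a, ωs a = conj (ω (star a)) := fun a => rfl
  -- The decomposition into real and imaginary parts; ω + ωs and -i(ω - ωs) are both hermitian.
  have : ω = (1 / 2 : ℂ) • (ω + ωs) + (Complex.I / 2) • ((-Complex.I) • (ω + (-1 : ℂ) • ωs)) := by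
    ext a
    simp only [add_apply, smul_apply, smul_eq_mul]
    linear_combination ((ω a - ωs a) / 2) * Complex.I_sq
  rw [this]
  refine add _ _ (smul _ _ (hherm _ fun a => ?_)) (smul _ _ (hherm _ fun a => ?_))
  · simp [hωs, add_comm]
  · simp [hωs]
    ring

end Functionals

/-! ### Uniform boundedness with weights -/

section WeakBounds

/-- A family in a normed space that is weakly bounded by nonnegative weights is bounded in norm by a
multiple of the weights. -/
lemma exists_norm_le_of_forall_dual {𝕜 E ι : Type*} [RCLike 𝕜] [NormedAddCommGroup E]
    [NormedSpace 𝕜 E] (v : ι → E) (w : ι → ℝ) (hw : ∀ i, 0 ≤ w i)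
    (h : ∀ τ : StrongDual 𝕜 E, ∃ C, ∀ i, ‖τ (v i)‖ ≤ C * w i) :
    ∃ C, 0 ≤ C ∧ ∀ i, ‖v i‖ ≤ C * w i := by
  -- Apply the principle to v i / w i in the bidual. Where w i = 0 the quotient is 0 by convention
  -- and carries no information, so v i = 0 is proved separately below.
  obtain ⟨C, hC⟩ := banach_steinhaus (𝕜 := 𝕜) (𝕜₂ := 𝕜)
    (g := fun i => ((w i)⁻¹ : 𝕜) • NormedSpace.inclusionInDoubleDual 𝕜 E (v i)) fun τ => by
      obtain ⟨C, hC⟩ := h τ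
      refine ⟨|C|, fun i => ?_⟩
      rw [smul_apply, NormedSpace.dual_def, norm_smul, norm_inv, RCLike.norm_ofReal,
        abs_of_nonneg (hw i)]
      rcases (hw i).eq_or_lt with h0 | h0
      · simp [← h0]
      · rw [inv_mul_le_iff₀ h0, mul_comm]
        exact (hC i).trans (mul_le_mul_of_nonneg_right (le_abs_self C) h0.le)
  refine ⟨|C|, abs_nonneg C, fun i => ?_⟩
  rcases (hw i).eq_or_lt with h0 | h0
  · have : v i = 0 := SeparatingDual.eq_zero_of_forall_dual_eq_zero (R := 𝕜) fun τ => by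
      obtain ⟨C, hC⟩ := h τ
      simpa [← h0] using hC i
    simp [this, ← h0]
  · have := hC i
    rw [norm_smul, norm_inv, RCLike.norm_ofReal, abs_of_nonneg (hw i), inv_mul_le_iff₀ h0] at this
    have hn : ‖NormedSpace.inclusionInDoubleDual 𝕜 E (v i)‖ = ‖v i‖ :=
      (NormedSpace.inclusionInDoubleDualLi 𝕜).norm_map (v i)
    rw [hn, mul_comm] at this
    exact this.trans (mul_le_mul_of_nonneg_right (le_abs_self C) h0.le)

end WeakBounds

/-! ### Slices by matrix coefficients -/

section SliceMaps

universe u v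

open Filter Topology CStarAlgebra
open scoped InnerProductSpace

attribute [local instance] CStarAlgebra.spectralOrder CStarAlgebra.spectralOrderedRing

variable {A : Type u} {B : Type v} [NonUnitalCStarAlgebra A] [NonUnitalCStarAlgebra B]

/-- The functional `a ↦ ⟪ξ, π(a) η⟫`. -/
noncomputable def CStarRep.coeff (π : CStarRep A) (ξ η : π.space) : A →ₗ[ℂ] ℂ where
  toFun a := ⟪ξ, π.hom a η⟫_ℂ
  map_add' a b := by simp
  map_smul' c a := by simp

lemma CStarRep.coeff_apply (π : CStarRep A) (ξ η : π.space) (a : A) :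
    π.coeff ξ η a = ⟪ξ, π.hom a η⟫_ℂ := rfl

/-- This and its left analogue move a factor e from the algebra into a vector, so that the defect of
a slice becomes a slice by a difference of vectors. -/
lemma CStarRep.coeff_mul_right (π : CStarRep A) (ξ η : π.space) (a e : A) :
    π.coeff ξ η (a * e) = π.coeff ξ (π.hom e η) a := by
  simp [coeff_apply]

lemma CStarRep.coeff_mul_left (π : CStarRep A) (ξ η : π.space) (a e : A) :
    π.coeff ξ η (e * a) = π.coeff (π.hom (star e) ξ) η a := by
  rw [coeff_apply, coeff_apply, map_star, ContinuousLinearMap.star_eq_adjoint,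
    ContinuousLinearMap.adjoint_inner_left, map_mul]
  rfl

namespace MinTensor

variable (B) in
/-- The slice map of a functional on the algebraic tensor product. -/
noncomputable def algSlice (φ : A →ₗ[ℂ] ℂ) : A ⊗[ℂ] B →ₗ[ℂ] B :=
  (TensorProduct.lid ℂ B).toLinearMap ∘ₗ LinearMap.rTensor B φ

@[simp] lemma algSlice_tmul (φ : A →ₗ[ℂ] ℂ) (a : A) (b : B) :
    algSlice B φ (a ⊗ₜ b) = φ a • b := by
  simp [algSlice]

/-- A coefficient of a slice is a coefficient of π ⊗ ρ at elementary tensors, which the spatial norm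
controls. -/
lemma coeff_algSlice (π : CStarRep A) (ρ : CStarRep B) (ξ η : π.space) (ζ ζ' : ρ.space)
    (x : A ⊗[ℂ] B) :
    ρ.coeff ζ ζ' (algSlice B (π.coeff ξ η) x) =
      ⟪HilbertTensor.incl _ _ (ξ ⊗ₜ[ℂ] ζ),
        repTensor π ρ x (HilbertTensor.incl _ _ (η ⊗ₜ[ℂ] ζ'))⟫_ℂ := by
  induction x with
  | zero => simp
  | add x y hx hy => simp only [map_add, add_apply, inner_add_right, hx, hy]
  | tmul a b =>
    rw [repTensor_tmul, opTensor_incl, LinearIsometry.inner_map_map, algSlice_tmul, map_smul,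
      smul_eq_mul]
    exact (TensorProduct.inner_tmul ..).symm

lemma norm_coeff_algSlice_le (π : CStarRep A) (ρ : CStarRep B) (ξ η : π.space) (ζ ζ' : ρ.space)
    (x : A ⊗[ℂ] B) :
    ‖ρ.coeff ζ ζ' (algSlice B (π.coeff ξ η) x)‖ ≤
      (‖ζ‖ * ‖ζ'‖) * (‖ξ‖ * ‖η‖ * spatialNorm x) := by
  rw [coeff_algSlice]
  calc _ ≤ _ * _ := norm_inner_le_norm _ _
    _ ≤ (‖ξ‖ * ‖ζ‖) * (spatialNorm x * (‖η‖ * ‖ζ'‖)) := by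
      rw [LinearIsometry.norm_map, TensorProduct.norm_tmul]
      gcongr
      refine (ContinuousLinearMap.le_opNorm _ _).trans ?_
      rw [LinearIsometry.norm_map, TensorProduct.norm_tmul]
      gcongr
      exact norm_repTensor_le π ρ x
    _ = _ := by ring

-- The constant is uniform in both vectors, so a small vector gives a small slice. To get this,
-- uniform boundedness is applied to the family indexed by ξ, η and x together; each functional on B
-- is reduced to vector functionals.
variable (B) in
lemma exists_norm_algSlice_coeff_le (π : CStarRep A) :
    ∃ C, 0 ≤ C ∧ ∀ (ξ η : π.space) (x : A ⊗[ℂ] B),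
      ‖algSlice B (π.coeff ξ η) x‖ ≤ C * (‖ξ‖ * ‖η‖ * spatialNorm x) := by
  obtain ⟨C, hC, h⟩ := exists_norm_le_of_forall_dual (𝕜 := ℂ)
    (fun p : π.space × π.space × (A ⊗[ℂ] B) => algSlice B (π.coeff p.1 p.2.1) p.2.2)
    (fun p => ‖p.1‖ * ‖p.2.1‖ * spatialNorm p.2.2)
    (fun p => mul_nonneg (by positivity) (spatialNorm_nonneg _)) fun τ => by
      induction τ using StrongDual.induction_on_vector with
      | add φ ψ hφ hψ =>
        obtain ⟨C, hC⟩ := hφ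
        obtain ⟨D, hD⟩ := hψ
        exact ⟨C + D, fun p => (norm_add_le _ _).trans
          ((add_le_add (hC p) (hD p)).trans_eq (add_mul _ _ _).symm)⟩
      | smul c φ hφ =>
        obtain ⟨C, hC⟩ := hφ
        refine ⟨‖c‖ * C, fun p => ?_⟩
        rw [smul_apply, norm_smul, mul_assoc]
        exact mul_le_mul_of_nonneg_left (hC p) (norm_nonneg c)
      | vector ρ ζ hζ φ hφ =>
        exact ⟨‖ζ‖ * ‖ζ‖, fun p => by
          rw [hφ]; exact norm_coeff_algSlice_le π ρ p.1 p.2.1 ζ ζ p.2.2⟩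
  exact ⟨C, hC, fun ξ η x => h (ξ, η, x)⟩

/-- Bounded linear maps on the minimal tensor product that agree on elementary tensors are equal. -/
lemma ext_tmul {E : Type*} [NormedAddCommGroup E] [NormedSpace ℂ E] {F G : MinTensor A B →L[ℂ] E}
    (h : ∀ a b, F (tmul a b) = G (tmul a b)) : F = G := by
  ext x
  refine congrFun (denseRange_incl.equalizer F.continuous G.continuous (funext fun y => ?_)) x
  change A ⊗[ℂ] B at y
  change F (incl A B y) = G (incl A B y)
  induction y with
  | zero => rw [show incl A B (0 : A ⊗[ℂ] B) = 0 from map_zero (incl A B), map_zero, map_zero]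
  | add y z hy hz =>
    rw [show incl A B (y + z : A ⊗[ℂ] B) = incl A B y + incl A B z from map_add (incl A B) y z,
      map_add, map_add, hy, hz]
  | tmul a b => exact h a b

lemma exists_slice_of_bound {φ : A →ₗ[ℂ] ℂ} {C : ℝ} (hC : 0 ≤ C)
    (h : ∀ x : A ⊗[ℂ] B, ‖algSlice B φ x‖ ≤ C * spatialNorm x) :
    ∃ S : MinTensor A B →L[ℂ] B, (∀ a b, S (tmul a b) = φ a • b) ∧ ‖S‖ ≤ C := by
  let T : AlgTensor A B →L[ℂ] B :=
    LinearMap.mkContinuous (algSlice B φ : A ⊗[ℂ] B →ₗ[ℂ] B) C h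
  let S : MinTensor A B →L[ℂ] B := T.fromCompletion
  have hS : ∀ x, S (incl A B x) = T x := fun x =>
    ContinuousLinearMap.fromCompletion_apply_coe T x
  refine ⟨S, fun a b => (hS _).trans (algSlice_tmul φ a b), ?_⟩
  refine ContinuousLinearMap.opNorm_le_bound _ hC fun x => ?_
  induction x using denseRange_incl.induction_on with
  | hp => exact isClosed_le (by fun_prop) (by fun_prop)
  | ih x => rw [hS, LinearIsometry.norm_map]; exact h x

end MinTensor

end SliceMaps

/-! ### The failure of a map to commute with multiplication -/

section Defects

variable {C B : Type*} [NonUnitalCStarAlgebra C] [NonUnitalCStarAlgebra B]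

/-- The map `y ↦ S(y) b - S(y c)`. -/
noncomputable def rightDefect (S : C →L[ℂ] B) (b : B) (c : C) : C →L[ℂ] B :=
  ((ContinuousLinearMap.mul ℂ B).flip b).comp S - S.comp ((ContinuousLinearMap.mul ℂ C).flip c)

/-- The map `y ↦ b S(y) - S(c y)`. -/
noncomputable def leftDefect (S : C →L[ℂ] B) (b : B) (c : C) : C →L[ℂ] B :=
  (ContinuousLinearMap.mul ℂ B b).comp S - S.comp (ContinuousLinearMap.mul ℂ C c)

lemma rightDefect_apply (S : C →L[ℂ] B) (b : B) (c y : C) :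
    rightDefect S b c y = S y * b - S (y * c) := rfl

lemma leftDefect_apply (S : C →L[ℂ] B) (b : B) (c y : C) :
    leftDefect S b c y = b * S y - S (c * y) := rfl

lemma rightDefect_add (S T : C →L[ℂ] B) (b : B) (c : C) :
    rightDefect (S + T) b c = rightDefect S b c + rightDefect T b c := by
  ext y; simp only [rightDefect_apply, add_apply, add_mul]; abel

lemma leftDefect_add (S T : C →L[ℂ] B) (b : B) (c : C) :
    leftDefect (S + T) b c = leftDefect S b c + leftDefect T b c := by
  ext y; simp only [leftDefect_apply, add_apply, mul_add]; abel

lemma rightDefect_smul (t : ℂ) (S : C →L[ℂ] B) (b : B) (c : C) :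
    rightDefect (t • S) b c = t • rightDefect S b c := by
  ext y; simp only [rightDefect_apply, smul_apply, smul_mul_assoc, smul_sub]

lemma leftDefect_smul (t : ℂ) (S : C →L[ℂ] B) (b : B) (c : C) :
    leftDefect (t • S) b c = t • leftDefect S b c := by
  ext y; simp only [leftDefect_apply, smul_apply, mul_smul_comm, smul_sub]

end Defects

/-! ### Slice maps and the vanishing of their defects -/

section Approximation

universe u v

open Filter Topology CStarAlgebra MinTensor
open scoped InnerProductSpace

attribute [local instance] CStarAlgebra.spectralOrder CStarAlgebra.spectralOrderedRing

variable {A : Type u} {B : Type v} [NonUnitalCStarAlgebra A] [NonUnitalCStarAlgebra B]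

lemma IsSliceMap.unique {ω : StrongDual ℂ A} {S T : MinTensor A B →L[ℂ] B}
    (hS : IsSliceMap ω S) (hT : IsSliceMap ω T) : S = T :=
  ext_tmul fun a b => (hS a b).trans (hT a b).symm

variable (B) in
/-- Slice maps exist, and they commute with multiplication by elements of `B` up to the insertion
of an approximate unit of `A`. -/
theorem exists_isSliceMap_tendsto_defect (ω : StrongDual ℂ A) :
    ∃ S : MinTensor A B →L[ℂ] B, IsSliceMap ω S ∧ ∀ b,
      Tendsto (fun e => rightDefect S b (tmul e b)) (approximateUnit A) (𝓝 0) ∧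
      Tendsto (fun e => leftDefect S b (tmul e b)) (approximateUnit A) (𝓝 0) := by
  induction ω using StrongDual.induction_on_vector with
  | add φ ψ hφ hψ =>
    obtain ⟨S, hS, hSd⟩ := hφ
    obtain ⟨T, hT, hTd⟩ := hψ
    refine ⟨S + T, fun a b => ?_, fun b => ⟨?_, ?_⟩⟩
    · rw [add_apply, add_apply, hS, hT, add_smul]
    · simpa only [rightDefect_add, add_zero] using (hSd b).1.add (hTd b).1
    · simpa only [leftDefect_add, add_zero] using (hSd b).2.add (hTd b).2
  | smul c φ hφ =>
    obtain ⟨S, hS, hSd⟩ := hφ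
    refine ⟨c • S, fun a b => ?_, fun b => ⟨?_, ?_⟩⟩
    · rw [smul_apply, smul_apply, hS, smul_assoc]
    · simpa only [rightDefect_smul, smul_zero] using (hSd b).1.const_smul c
    · simpa only [leftDefect_smul, smul_zero] using (hSd b).2.const_smul c
  | vector π ξ hξ φ hφ =>
    obtain ⟨C, hC, hbound⟩ := exists_norm_algSlice_coeff_le B π
    have hslice : ∀ η η' : π.space, ∃ S : MinTensor A B →L[ℂ] B,
        (∀ a b, S (tmul a b) = π.coeff η η' a • b) ∧ ‖S‖ ≤ C * (‖η‖ * ‖η'‖) := fun η η' =>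
      exists_slice_of_bound (by positivity) fun x => (hbound η η' x).trans_eq (by ring)
    choose S hS hSn using hslice
    have hξ0 : Tendsto (fun e => ‖ξ - π.hom e ξ‖) (approximateUnit A) (𝓝 0) := by
      have h : Tendsto (fun e => π.hom e ξ) (approximateUnit A) (𝓝 ξ) := hξ
      simpa using ((tendsto_const_nhds (x := ξ)).sub h).norm
    refine ⟨S ξ ξ, fun a b => by rw [hS, hφ]; rfl, fun b => ⟨?_, ?_⟩⟩
    · refine squeeze_zero_norm (a := fun e => ‖b‖ * (C * (‖ξ‖ * ‖ξ - π.hom e ξ‖))) (fun e => ?_)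
        (by simpa using ((hξ0.const_mul ‖ξ‖).const_mul C).const_mul ‖b‖)
      -- On a ⊗ c both sides are (⟪ξ, π(a)ξ⟫ - ⟪ξ, π(a)π(e)ξ⟫)cb.
      have h : rightDefect (S ξ ξ) b (tmul e b) =
          ((ContinuousLinearMap.mul ℂ B).flip b).comp (S ξ (ξ - π.hom e ξ)) :=
        ext_tmul fun a c => by
          change S ξ ξ (tmul a c) * b - S ξ ξ (tmul a c * tmul e b) =
            S ξ (ξ - π.hom e ξ) (tmul a c) * b
          rw [tmul_mul_tmul, hS, hS, hS, CStarRep.coeff_mul_right, smul_mul_assoc, smul_mul_assoc,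
            ← sub_smul, CStarRep.coeff_apply, CStarRep.coeff_apply, CStarRep.coeff_apply,
            map_sub, inner_sub_right]
      rw [h]
      refine (ContinuousLinearMap.opNorm_comp_le _ _).trans
        (mul_le_mul ?_ (hSn _ _) (norm_nonneg _) (norm_nonneg _))
      exact ContinuousLinearMap.opNorm_le_bound _ (norm_nonneg b) fun y =>
        (norm_mul_le y b).trans_eq (mul_comm _ _)
    · refine squeeze_zero_norm' (a := fun e => ‖b‖ * (C * (‖ξ - π.hom e ξ‖ * ‖ξ‖))) ?_
        (by simpa using ((hξ0.mul_const ‖ξ‖).const_mul C).const_mul ‖b‖)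
      -- Multiplication from the left puts e⋆ on the first vector, so e must be selfadjoint here.
      filter_upwards [(increasingApproximateUnit A).eventually_star_eq] with e he
      have h : leftDefect (S ξ ξ) b (tmul e b) =
          (ContinuousLinearMap.mul ℂ B b).comp (S (ξ - π.hom e ξ) ξ) :=
        ext_tmul fun a c => by
          change b * S ξ ξ (tmul a c) - S ξ ξ (tmul e b * tmul a c) =
            b * S (ξ - π.hom e ξ) ξ (tmul a c)
          rw [tmul_mul_tmul, hS, hS, hS, CStarRep.coeff_mul_left, he, mul_smul_comm, mul_smul_comm,
            ← sub_smul, CStarRep.coeff_apply, CStarRep.coeff_apply, CStarRep.coeff_apply,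
            inner_sub_left]
      rw [h]
      exact (ContinuousLinearMap.opNorm_comp_le _ _).trans
        (mul_le_mul (ContinuousLinearMap.opNorm_mul_apply_le ℂ B b) (hSn _ _) (norm_nonneg _)
          (norm_nonneg _))

end Approximation

/-! ### Multipliers and strict convergence -/

section StrictTopology

open Filter Topology CStarAlgebra

attribute [local instance] CStarAlgebra.spectralOrder CStarAlgebra.spectralOrderedRing

lemma exists_tendsto_of_approx {κ E : Type*} [NormedAddCommGroup E] [CompleteSpace E]
    {F : Filter κ} [F.NeBot] {g : κ → E}
    (h : ∀ ε > 0, ∃ (g' : κ → E) (z : E), Tendsto g' F (𝓝 z) ∧ ∀ᶠ k in F, ‖g k - g' k‖ ≤ ε) :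
    ∃ z, Tendsto g F (𝓝 z) := by
  refine cauchy_map_iff_exists_tendsto.1 (Metric.cauchy_iff.2 ⟨inferInstance, fun ε hε => ?_⟩)
  obtain ⟨g', z, hz, hg⟩ := h (ε / 4) (by positivity)
  refine ⟨Metric.ball z (ε / 2), ?_, fun x hx y hy => ?_⟩
  · rw [mem_map]
    filter_upwards [hg, Metric.tendsto_nhds.1 hz (ε / 4) (by positivity)] with k h1 h2
    rw [← dist_eq_norm] at h1
    rw [Set.mem_preimage, Metric.mem_ball]
    linarith [dist_triangle (g k) (g' k) z]
  · rw [Metric.mem_ball] at hx hy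
    linarith [dist_triangle_right x y z]

variable {C B : Type*} [NonUnitalCStarAlgebra C] [NonUnitalCStarAlgebra B]

/-- Test on w = (u - v)⋆ and use the C⋆-identity. -/
lemma eq_of_forall_mul_right_eq {u v : C} (h : ∀ w, u * w = v * w) : u = v := by
  have h1 := h (star (u - v))
  rw [← sub_eq_zero, ← sub_mul, CStarRing.mul_star_self_eq_zero_iff] at h1
  exact sub_eq_zero.1 h1

lemma eq_of_forall_mul_left_eq {u v : C} (h : ∀ w, w * u = w * v) : u = v := by
  have h1 := h (star (u - v))
  rw [← sub_eq_zero, ← mul_sub, CStarRing.star_mul_self_eq_zero_iff] at h1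
  exact sub_eq_zero.1 h1

namespace DoubleCentralizer

lemma snd_mul (x : 𝓜(ℂ, C)) (y z : C) : x.snd (y * z) = y * x.snd z :=
  eq_of_forall_mul_right_eq fun w => by rw [x.central, mul_assoc, mul_assoc, x.central]

lemma ext_fst {x y : 𝓜(ℂ, C)} (h : ∀ c, x.fst c = y.fst c) : x = y :=
  ext _ _ _ _ (Prod.ext (ContinuousLinearMap.ext h) (ContinuousLinearMap.ext fun c =>
    eq_of_forall_mul_right_eq fun w => by rw [x.central, y.central, h]))

lemma ext_snd {x y : 𝓜(ℂ, C)} (h : ∀ c, x.snd c = y.snd c) : x = y :=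
  ext_fst fun c => eq_of_forall_mul_left_eq fun w => by rw [← x.central, ← y.central, h]

lemma norm_snd_apply_le (x : 𝓜(ℂ, C)) (c : C) : ‖x.snd c‖ ≤ ‖x‖ * ‖c‖ := by
  simpa using x.snd.le_opNorm c

/-- The embedding in the multiplier algebra is a contraction. -/
lemma norm_coe_le (c : C) : ‖(c : 𝓜(ℂ, C))‖ ≤ ‖c‖ := by
  rw [← norm_fst, coe_fst]
  exact ContinuousLinearMap.opNorm_mul_apply_le ℂ C c

lemma tendsto_strictTopology_iff {κ : Type*} {F : Filter κ} {g : κ → 𝓜(ℂ, C)} {x : 𝓜(ℂ, C)} :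
    Tendsto g F (@nhds _ (strictTopology C) x) ↔
      ∀ c, Tendsto (fun k => (g k).fst c) F (𝓝 (x.fst c)) ∧
        Tendsto (fun k => (g k).snd c) F (𝓝 (x.snd c)) := by
  have h : @nhds _ (strictTopology C) x = (⨅ c : C, comap (fun z => z.fst c) (𝓝 (x.fst c))) ⊓
      (⨅ c : C, comap (fun z => z.snd c) (𝓝 (x.snd c))) := by
    have h := @nhds_inf _
      (⨅ c : C, TopologicalSpace.induced (fun z : 𝓜(ℂ, C) => z.fst c) inferInstance)
      (⨅ c : C, TopologicalSpace.induced (fun z : 𝓜(ℂ, C) => z.snd c) inferInstance) x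
    rw [nhds_iInf, nhds_iInf] at h
    simpa only [nhds_induced] using h
  rw [h]
  simp only [tendsto_inf, tendsto_iInf, tendsto_comap_iff, forall_and]
  rfl

/-- The multiplier algebra is complete for bounded strict convergence. -/
lemma exists_of_tendsto_mul {κ : Type*} {F : Filter κ} [F.NeBot] {y : κ → B} {K : ℝ}
    (hK : ∀ᶠ k in F, ‖y k‖ ≤ K) (hr : ∀ b, ∃ z, Tendsto (fun k => y k * b) F (𝓝 z))
    (hl : ∀ b, ∃ z, Tendsto (fun k => b * y k) F (𝓝 z)) :
    ∃ m : 𝓜(ℂ, B), ‖m‖ ≤ K ∧ ∀ b, Tendsto (fun k => y k * b) F (𝓝 (m.fst b)) ∧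
      Tendsto (fun k => b * y k) F (𝓝 (m.snd b)) := by
  choose L hL using hr
  choose R hR using hl
  have hK0 : 0 ≤ K := by
    obtain ⟨k, hk⟩ := hK.exists
    exact (norm_nonneg _).trans hk
  have hLn : ∀ b, ‖L b‖ ≤ K * ‖b‖ := fun b => by
    refine le_of_tendsto (hL b).norm ?_
    filter_upwards [hK] with k hk
    exact (norm_mul_le _ _).trans (by gcongr)
  have hRn : ∀ b, ‖R b‖ ≤ K * ‖b‖ := fun b => by
    refine le_of_tendsto (hR b).norm ?_
    filter_upwards [hK] with k hk
    rw [mul_comm K]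
    exact (norm_mul_le _ _).trans (by gcongr)
  let L' : B →L[ℂ] B := LinearMap.mkContinuous
    { toFun := L
      map_add' := fun b c => tendsto_nhds_unique (hL (b + c)) <| by
        simpa only [mul_add] using (hL b).add (hL c)
      map_smul' := fun t b => tendsto_nhds_unique (hL (t • b)) <| by
        simpa only [mul_smul_comm] using! (hL b).const_smul t } K hLn
  let R' : B →L[ℂ] B := LinearMap.mkContinuous
    { toFun := R
      map_add' := fun b c => tendsto_nhds_unique (hR (b + c)) <| by
        simpa only [add_mul] using (hR b).add (hR c)
      map_smul' := fun t b => tendsto_nhds_unique (hR (t • b)) <| by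
        simpa only [smul_mul_assoc] using! (hR b).const_smul t } K hRn
  -- The centralizer identity is the limit of (b y)c = b(y c).
  let m : 𝓜(ℂ, B) :=
    { fst := L'
      snd := R'
      central := fun b c => tendsto_nhds_unique ((hR b).mul_const c) <| by
        simpa only [mul_assoc] using! (hL c).const_mul b }
  refine ⟨m, ?_, fun b => ⟨hL b, hR b⟩⟩
  rw [← norm_fst]
  exact ContinuousLinearMap.opNorm_le_bound _ hK0 hLn

lemma eventually_norm_snd_le (x : 𝓜(ℂ, C)) :
    ∀ᶠ f in approximateUnit C, ‖x.snd f‖ ≤ ‖x‖ := by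
  filter_upwards [(increasingApproximateUnit C).eventually_norm] with f hf
  exact (x.norm_snd_apply_le f).trans (mul_le_of_le_one_right (norm_nonneg x) hf)

/-- The elements `f x` converge strictly to the multiplier `x` as `f` runs through the approximate
unit. -/
lemma tendsto_snd_approximateUnit_mul (x : 𝓜(ℂ, C)) (c : C) :
    Tendsto (fun f => x.snd f * c) (approximateUnit C) (𝓝 (x.fst c)) := by
  simpa only [x.central] using (increasingApproximateUnit C).tendsto_mul_right (x.fst c)

lemma tendsto_mul_snd_approximateUnit (x : 𝓜(ℂ, C)) (c : C) :
    Tendsto (fun f => c * x.snd f) (approximateUnit C) (𝓝 (x.snd c)) := by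
  simp only [← snd_mul]
  exact (x.snd.continuous.tendsto c).comp ((increasingApproximateUnit C).tendsto_mul_left c)

end DoubleCentralizer

/-! ### Extension by strict limits -/

open DoubleCentralizer

variable {ι : Type*} {l : Filter ι} {S : C →L[ℂ] B} {c : ι → B → C}

/-- A bounded map that commutes with multiplications up to small defects extends to the multiplier
algebras by strict limits. -/
lemma exists_strictLimit_map [l.NeBot]
    (hr : ∀ b, Tendsto (fun i => rightDefect S b (c i b)) l (𝓝 0))
    (hl : ∀ b, Tendsto (fun i => leftDefect S b (c i b)) l (𝓝 0)) :
    ∃ Φ : 𝓜(ℂ, C) →L[ℂ] 𝓜(ℂ, B), ∀ x b,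
      Tendsto (fun f => S (x.snd f) * b) (approximateUnit C) (𝓝 ((Φ x).fst b)) ∧
      Tendsto (fun f => b * S (x.snd f)) (approximateUnit C) (𝓝 ((Φ x).snd b)) := by
  have key : ∀ x : 𝓜(ℂ, C), ∃ m : 𝓜(ℂ, B), ‖m‖ ≤ ‖S‖ * ‖x‖ ∧ ∀ b,
      Tendsto (fun f => S (x.snd f) * b) (approximateUnit C) (𝓝 (m.fst b)) ∧
      Tendsto (fun f => b * S (x.snd f)) (approximateUnit C) (𝓝 (m.snd b)) := fun x => by
    -- Since ‖fx‖ ≤ ‖x‖ eventually, one index i serves all late f. Thus S(fx)b is uniformly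
    -- approximated by S(fx·c i b), which converges to S(x·c i b).
    have hsmall : ∀ {d : ι → C →L[ℂ] B}, Tendsto d l (𝓝 0) → ∀ ε > 0, ∃ i,
        ∀ᶠ f in approximateUnit C, ‖d i (x.snd f)‖ ≤ ε := fun {d} hd ε hε => by
      have h0 : Tendsto (fun i => ‖d i‖ * ‖x‖) l (𝓝 0) := by
        simpa using hd.norm.mul_const ‖x‖
      obtain ⟨i, hi⟩ := (h0.eventually (gt_mem_nhds hε)).exists
      refine ⟨i, ?_⟩
      filter_upwards [x.eventually_norm_snd_le] with f hf
      exact ((d i).le_opNorm_of_le hf).trans hi.le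
    refine exists_of_tendsto_mul ?_ (fun b => ?_) fun b => ?_
    · filter_upwards [x.eventually_norm_snd_le] with f hf
      exact S.le_opNorm_of_le hf
    · refine exists_tendsto_of_approx fun ε hε => ?_
      obtain ⟨i, hi⟩ := hsmall (hr b) ε hε
      exact ⟨fun f => S (x.snd f * c i b), _,
        (S.continuous.tendsto _).comp (x.tendsto_snd_approximateUnit_mul (c i b)), hi⟩
    · refine exists_tendsto_of_approx fun ε hε => ?_
      obtain ⟨i, hi⟩ := hsmall (hl b) ε hε
      exact ⟨fun f => S (c i b * x.snd f), _,
        (S.continuous.tendsto _).comp (x.tendsto_mul_snd_approximateUnit (c i b)), hi⟩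
  choose Φ hΦn hΦ using key
  refine ⟨LinearMap.mkContinuous
    { toFun := Φ
      map_add' := fun x y => ext_fst fun b => tendsto_nhds_unique (hΦ (x + y) b).1 <| by
        simpa only [add_snd, add_apply, map_add, add_mul] using! (hΦ x b).1.add (hΦ y b).1
      map_smul' := fun t x => ext_fst fun b => tendsto_nhds_unique (hΦ (t • x) b).1 <| by
        simpa only [smul_snd, smul_apply, map_smul, smul_mul_assoc] using!
          (hΦ x b).1.const_smul t } ‖S‖ hΦn, hΦ⟩

variable {Φ : 𝓜(ℂ, C) →L[ℂ] 𝓜(ℂ, B)}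

/-- The limit over f of the defect bound at fx. It involves x only through ‖x‖, which gives the
uniformity needed for strict continuity. -/
lemma norm_strictLimit_fst_sub_le
    (hΦ : ∀ x b, Tendsto (fun f => S (x.snd f) * b) (approximateUnit C) (𝓝 ((Φ x).fst b)))
    (x : 𝓜(ℂ, C)) (b : B) (d : C) :
    ‖(Φ x).fst b - S (x.fst d)‖ ≤ ‖rightDefect S b d‖ * ‖x‖ := by
  refine le_of_tendsto ((hΦ x b).sub
    ((S.continuous.tendsto _).comp (x.tendsto_snd_approximateUnit_mul d))).norm ?_
  filter_upwards [x.eventually_norm_snd_le] with f hf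
  exact (rightDefect S b d).le_opNorm_of_le hf

lemma norm_strictLimit_snd_sub_le
    (hΦ : ∀ x b, Tendsto (fun f => b * S (x.snd f)) (approximateUnit C) (𝓝 ((Φ x).snd b)))
    (x : 𝓜(ℂ, C)) (b : B) (d : C) :
    ‖(Φ x).snd b - S (x.snd d)‖ ≤ ‖leftDefect S b d‖ * ‖x‖ := by
  refine le_of_tendsto ((hΦ x b).sub
    ((S.continuous.tendsto _).comp (x.tendsto_mul_snd_approximateUnit d))).norm ?_
  filter_upwards [x.eventually_norm_snd_le] with f hf
  exact (leftDefect S b d).le_opNorm_of_le hf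

/-- A second description of Φ(x)b, with the approximation next to b instead of to the left of x; the
module identities are read off from it. -/
lemma tendsto_strictLimit_fst
    (hr : ∀ b, Tendsto (fun i => rightDefect S b (c i b)) l (𝓝 0))
    (hΦ : ∀ x b, Tendsto (fun f => S (x.snd f) * b) (approximateUnit C) (𝓝 ((Φ x).fst b)))
    (x : 𝓜(ℂ, C)) (b : B) : Tendsto (fun i => S (x.fst (c i b))) l (𝓝 ((Φ x).fst b)) := by
  refine tendsto_iff_norm_sub_tendsto_zero.2 (squeeze_zero (fun _ => norm_nonneg _) (fun i => ?_)
    (by simpa using (hr b).norm.mul_const ‖x‖))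
  rw [norm_sub_rev]
  exact norm_strictLimit_fst_sub_le hΦ x b (c i b)

lemma tendsto_strictLimit_snd
    (hl : ∀ b, Tendsto (fun i => leftDefect S b (c i b)) l (𝓝 0))
    (hΦ : ∀ x b, Tendsto (fun f => b * S (x.snd f)) (approximateUnit C) (𝓝 ((Φ x).snd b)))
    (x : 𝓜(ℂ, C)) (b : B) : Tendsto (fun i => S (x.snd (c i b))) l (𝓝 ((Φ x).snd b)) := by
  refine tendsto_iff_norm_sub_tendsto_zero.2 (squeeze_zero (fun _ => norm_nonneg _) (fun i => ?_)
    (by simpa using (hl b).norm.mul_const ‖x‖))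
  rw [norm_sub_rev]
  exact norm_strictLimit_snd_sub_le hΦ x b (c i b)

lemma tendsto_of_uniform_approx {κ E : Type*} [NormedAddCommGroup E] {F : Filter κ}
    {g : κ → E} {z : E}
    (h : ∀ ε > 0, ∃ (g' : κ → E) (z' : E), Tendsto g' F (𝓝 z') ∧
      (∀ᶠ k in F, ‖g k - g' k‖ ≤ ε) ∧ ‖z - z'‖ ≤ ε) : Tendsto g F (𝓝 z) := by
  refine Metric.tendsto_nhds.2 fun ε hε => ?_
  obtain ⟨g', z', hg', hg, hz⟩ := h (ε / 4) (by positivity)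
  filter_upwards [hg, Metric.tendsto_nhds.1 hg' (ε / 4) (by positivity)] with k h1 h2
  rw [← dist_eq_norm] at h1 hz
  rw [dist_comm] at hz
  linarith [dist_triangle4 (g k) (g' k) z' z]

/-- On the ball, y ↦ Φ(y)b is a uniform limit of the maps y ↦ S(y·c i b), each strictly continuous;
the same holds on the left. -/
lemma strictlyContinuousOnUnitBall_strictLimit [l.NeBot]
    (hr : ∀ b, Tendsto (fun i => rightDefect S b (c i b)) l (𝓝 0))
    (hl : ∀ b, Tendsto (fun i => leftDefect S b (c i b)) l (𝓝 0))
    (hΦ : ∀ x b, Tendsto (fun f => S (x.snd f) * b) (approximateUnit C) (𝓝 ((Φ x).fst b)) ∧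
      Tendsto (fun f => b * S (x.snd f)) (approximateUnit C) (𝓝 ((Φ x).snd b))) :
    StrictlyContinuousOnUnitBall Φ := by
  intro x hx
  set F := @nhdsWithin _ (strictTopology C) x (Metric.closedBall 0 1)
  have hid := tendsto_strictTopology_iff.1
    (show Tendsto (fun y => y) F (@nhds _ (strictTopology C) x) from
      @nhdsWithin_le_nhds _ (strictTopology C) _ _)
  have hmem : ∀ᶠ y in F, ‖y‖ ≤ 1 := by
    have : ∀ᶠ y in F, y ∈ Metric.closedBall (0 : 𝓜(ℂ, C)) 1 :=
      @self_mem_nhdsWithin _ (strictTopology C) _ _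
    simpa using this
  rw [mem_closedBall_zero_iff] at hx
  have hsmall : ∀ {d : ι → C →L[ℂ] B}, Tendsto d l (𝓝 0) → ∀ ε > 0, ∃ i, ‖d i‖ ≤ ε :=
    fun {d} hd ε hε => by
      obtain ⟨i, hi⟩ := (hd.norm.eventually (gt_mem_nhds (by simpa using hε))).exists
      exact ⟨i, hi.le⟩
  have hle : ∀ {u ε : ℝ} {y : 𝓜(ℂ, C)}, 0 ≤ u → u ≤ ε → ‖y‖ ≤ 1 → u * ‖y‖ ≤ ε :=
    fun hu huε hy => (mul_le_of_le_one_right hu hy).trans huε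
  refine tendsto_strictTopology_iff.2 fun b => ⟨?_, ?_⟩
  · refine tendsto_of_uniform_approx fun ε hε => ?_
    obtain ⟨i, hi⟩ := hsmall (hr b) ε hε
    refine ⟨fun y => S (y.fst (c i b)), _, (S.continuous.tendsto _).comp (hid (c i b)).1, ?_, ?_⟩
    · filter_upwards [hmem] with y hy
      exact (norm_strictLimit_fst_sub_le (fun x b => (hΦ x b).1) y b (c i b)).trans
        (hle (norm_nonneg _) hi hy)
    · exact (norm_strictLimit_fst_sub_le (fun x b => (hΦ x b).1) x b (c i b)).trans
        (hle (norm_nonneg _) hi hx)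
  · refine tendsto_of_uniform_approx fun ε hε => ?_
    obtain ⟨i, hi⟩ := hsmall (hl b) ε hε
    refine ⟨fun y => S (y.snd (c i b)), _, (S.continuous.tendsto _).comp (hid (c i b)).2, ?_, ?_⟩
    · filter_upwards [hmem] with y hy
      exact (norm_strictLimit_snd_sub_le (fun x b => (hΦ x b).2) y b (c i b)).trans
        (hle (norm_nonneg _) hi hy)
    · exact (norm_strictLimit_snd_sub_le (fun x b => (hΦ x b).2) x b (c i b)).trans
        (hle (norm_nonneg _) hi hx)

lemma strictLimit_coe
    (hΦ : ∀ x b, Tendsto (fun f => S (x.snd f) * b) (approximateUnit C) (𝓝 ((Φ x).fst b)))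
    (y : C) : Φ (y : 𝓜(ℂ, C)) = (S y : 𝓜(ℂ, B)) :=
  ext_fst fun b => tendsto_nhds_unique (hΦ y b)
    (((S.continuous.tendsto y).comp
      ((increasingApproximateUnit C).tendsto_mul_right y)).mul_const b)

/-- Extensions to the multiplier algebras that are strictly continuous on the unit ball are
determined by strict limits. -/
lemma tendsto_strictExtension_fst {Ψ : 𝓜(ℂ, C) →L[ℂ] 𝓜(ℂ, B)}
    (hext : ∀ y : C, Ψ (y : 𝓜(ℂ, C)) = (S y : 𝓜(ℂ, B))) (hΨ : StrictlyContinuousOnUnitBall Ψ)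
    {x : 𝓜(ℂ, C)} (hx : ‖x‖ ≤ 1) (b : B) :
    Tendsto (fun f => S (x.snd f) * b) (approximateUnit C) (𝓝 ((Ψ x).fst b)) := by
  have hmem : ∀ᶠ f in approximateUnit C, (x.snd f : 𝓜(ℂ, C)) ∈ Metric.closedBall 0 1 := by
    filter_upwards [x.eventually_norm_snd_le] with f hf
    exact mem_closedBall_zero_iff.2 ((norm_coe_le _).trans (hf.trans hx))
  -- The elements fx converge strictly to x without leaving the ball, so continuity of Ψ on the ball
  -- suffices.
  have ht : Tendsto (fun f => (x.snd f : 𝓜(ℂ, C))) (approximateUnit C)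
      (@nhdsWithin _ (strictTopology C) x (Metric.closedBall 0 1)) :=
    tendsto_inf.2 ⟨tendsto_strictTopology_iff.2 fun d =>
      ⟨x.tendsto_snd_approximateUnit_mul d, x.tendsto_mul_snd_approximateUnit d⟩,
      tendsto_principal.2 hmem⟩
  have hc : Tendsto Ψ (@nhdsWithin _ (strictTopology C) x (Metric.closedBall 0 1))
      (@nhds _ (strictTopology B) (Ψ x)) := hΨ x (mem_closedBall_zero_iff.2 hx)
  have := (tendsto_strictTopology_iff.1 (hc.comp ht) b).1
  refine this.congr fun f => ?_
  rw [Function.comp_apply, hext]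
  rfl

lemma ContinuousLinearMap.eq_of_forall_norm_le_one {E F : Type*} [NormedAddCommGroup E]
    [NormedSpace ℂ E] [NormedAddCommGroup F] [NormedSpace ℂ F] {f g : E →L[ℂ] F}
    (h : ∀ x, ‖x‖ ≤ 1 → f x = g x) : f = g := by
  ext x
  rcases eq_or_ne x 0 with rfl | hx
  · simp
  · have hn : (‖x‖ : ℂ)⁻¹ ≠ 0 := by simpa using hx
    have := h ((‖x‖ : ℂ)⁻¹ • x) (by
      rw [norm_smul, norm_inv, Complex.norm_real, norm_norm,
        inv_mul_cancel₀ (norm_ne_zero_iff.2 hx)])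
    rwa [map_smul, map_smul, smul_right_inj hn] at this

end StrictTopology

/-! ### The theorem -/

section Main

open Filter Topology CStarAlgebra DoubleCentralizer

attribute [local instance] CStarAlgebra.spectralOrder CStarAlgebra.spectralOrderedRing

theorem theorem2p1 {A : Type*} {B : Type*} [NonUnitalCStarAlgebra A] [NonUnitalCStarAlgebra B]
    (ω : StrongDual ℂ A) :
    (∃! S : MinTensor A B →L[ℂ] B, IsSliceMap ω S) ∧
    ∀ S : MinTensor A B →L[ℂ] B, IsSliceMap ω S →
      ∃ Φ : 𝓜(ℂ, MinTensor A B) →L[ℂ] 𝓜(ℂ, B),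
        IsStrictExtension S Φ ∧
        (∀ Ψ : 𝓜(ℂ, MinTensor A B) →L[ℂ] 𝓜(ℂ, B), IsStrictExtension S Ψ → Ψ = Φ) ∧
        ∀ (x : 𝓜(ℂ, MinTensor A B)) (b : B),
          (b : 𝓜(ℂ, B)) * Φ x = Φ (MinTensor.oneTmul A b * x) ∧
          Φ x * (b : 𝓜(ℂ, B)) = Φ (x * MinTensor.oneTmul A b) := by
  obtain ⟨S, hS, hd⟩ := exists_isSliceMap_tendsto_defect B ω
  refine ⟨⟨S, hS, fun T hT => hT.unique hS⟩, fun T hT => ?_⟩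
  rw [hT.unique hS]
  have hr := fun b => (hd b).1
  have hl := fun b => (hd b).2
  obtain ⟨Φ, hΦ⟩ := exists_strictLimit_map hr hl
  have hΦ₁ := fun x b => (hΦ x b).1
  have hΦ₂ := fun x b => (hΦ x b).2
  refine ⟨Φ, ⟨strictLimit_coe hΦ₁, strictlyContinuousOnUnitBall_strictLimit hr hl hΦ⟩,
    fun Ψ hΨ => ContinuousLinearMap.eq_of_forall_norm_le_one fun x hx => ext_fst fun b =>
      tendsto_nhds_unique (tendsto_strictExtension_fst hΨ.extends_map hΨ.strict hx b) (hΦ₁ x b),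
    fun x b => ⟨ext_snd fun d => ?_, ext_fst fun d => ?_⟩⟩
  -- Both sides, multiplied on the left by d, are limits of S((e ⊗ db)x), because (e ⊗ d)(1 ⊗ b) = e
  -- ⊗ db. The other identity uses (1 ⊗ b)(e ⊗ d) = e ⊗ bd.
  · refine tendsto_nhds_unique (tendsto_strictLimit_snd hl hΦ₂ x (d * b)) ?_
    refine (tendsto_strictLimit_snd hl hΦ₂ (MinTensor.oneTmul A b * x) d).congr fun e => ?_
    exact congrArg (fun z => S (x.snd z)) (MinTensor.oneTmul_snd_tmul b e d)
  · refine tendsto_nhds_unique (tendsto_strictLimit_fst hr hΦ₁ x (b * d)) ?_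
    refine (tendsto_strictLimit_fst hr hΦ₁ (x * MinTensor.oneTmul A b) d).congr fun e => ?_
    exact congrArg (fun z => S (x.fst z)) (MinTensor.oneTmul_fst_tmul b e d)

end Main
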